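/- Fix the following notions. For $x=(x_0,\dots,x_{n-1})\in\{0,1\}^n$ and $w\in\{0,1\}^k$ with $1\le k\le n$, let $\#(w,x)$ be the number of $a\in\{0,\dots,n-k\}$ with $(x_a,\dots,x_{a+k-1})=w$, i.e. the multiplicity of $w$ in the multiset of all contiguous length-$k$ subwords of $x$. A trace of $x$ is a random string drawn from $\mathrm{Del}_\delta(x)$: each bit of $x$ is independently deleted with probability $\delta$, and the surviving bits are concatenated in order. The model of computation is a deterministic random access machine on natural numbers with uniform cost for every instruction (addition, truncated subtraction, indexed memory access, tests and so on), except that multiplication and division are charged their schoolbook bit cost, and drawing a trace $y$ costs $1+|y|$. The machine is given $n$, $k$, the string $w$, access to the binary digits of $\delta$ and of a confidence parameter $\tau$ (one digit per unit of time), and access to independent traces of $x$. **Theorem.** There are an algorithm and an absolute constant $C$ such that the following holds for all $0<\delta<1/2$, all $0<\tau<1$, all $1\le k\le n$ and all $w\in\{0,1\}^k$. For every unknown source string $x\in\{0,1\}^n$, the algorithm, given $n$, $w$, $\delta$, $\tau$ and access to independent traces from $\mathrm{Del}_\delta(x)$, always draws at most $$C\,n^{C}\,\Bigl(\tfrac12-\delta\Bigr)^{-Ck}\,\ln\frac{2}{\tau}$$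 traces and always halts within at most that many units of time, and with probability at least $1-\tau$ over the traces its output is $\#(w,x)$. -/

import Mathlib

open MeasureTheory ProbabilityTheory

/-! ### Strings, subwords and the deletion channel -/

/-- The `k`-subword deck of `x = x₀ … xₙ₋₁`: the multiset of all contiguous subwords
`x_a … x_{a+k-1}` with `0 ≤ a ≤ n - k` (empty if `n < k`). -/
def subwordDeck (x : List Bool) (k : ℕ) : Multiset (List Bool) :=
  (Multiset.range (x.length + 1 - k)).map fun a => (x.drop a).take k

/-- `#(w, x)`: the number of occurrences of `w` as a contiguous subword of `x`, i.e. the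
multiplicity of `w` in the `|w|`-subword deck of `x`. -/
def subwordMultiplicity (w x : List Bool) : ℕ :=
  (subwordDeck x w.length).count w

/-- `Del_δ(x)`: every bit of `x` is independently deleted with probability `δ`, and the surviving
bits are concatenated in order. -/
noncomputable def deletionChannel (δ : unitInterval) : List Bool → PMF (List Bool)
  | [] => PMF.pure []
  | b :: x =>
      (PMF.bernoulli (unitInterval.toNNReal δ) δ.2.2).bind
        fun deleted => (deletionChannel δ x).map fun y => if deleted then y else b :: y

instance instMeasurableSpaceListBool : MeasurableSpace (List Bool) := ⊤

/-- The law of an infinite sequence of independent traces of `x`. -/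
noncomputable def traceStream (δ : unitInterval) (x : List Bool) : Measure (ℕ → List Bool) :=
  Measure.infinitePi fun _ : ℕ => (deletionChannel δ x).toMeasure

/-! ### The machine model

A deterministic random access machine over the natural numbers.  It has registers and finitely many
arrays (those named in the program), all initially zero except for the input, and is programmed in
a structured language.  Besides its input it has access to

* a source of traces: each `draw` instruction delivers the next string of a sequence of strings;
* the binary digits of two real parameters, one digit per query.

Running time is the uniform cost of the textbook random access machine: one unit for every
constant, register access, array access, addition, (truncated) subtraction, digit query, assignment
and test.  Multiplication and division are not unit-cost: they are charged their schoolbook bit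
cost, so that numbers never get longer than the time elapsed permits.  Drawing a trace is charged
one unit plus the length of the trace. -/

/-- What the machine can query from outside: the digits of its two real parameters, and the sequence
of traces. -/
structure Env where
  digit₁ : ℕ → ℕ
  digit₂ : ℕ → ℕ
  trace : ℕ → List Bool

/-- The `m`-th binary digit after the point of a nonnegative real number `r`, for `m ≥ 1`
(for `m = 0` the parity of its integer part). -/
noncomputable def binaryDigit (r : ℝ) (m : ℕ) : ℕ := ⌊r * 2 ^ m⌋₊ % 2

/-- A memory state: `reg i` is the content of register `i`, `arr a i` is the content of cell `i` of
array `a`, and `drawn` is the number of traces drawn so far. -/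
structure State where
  reg : ℕ → ℕ
  arr : ℕ → ℕ → ℕ
  drawn : ℕ

/-- Arithmetic expressions. `get a e` reads the cell of array `a` whose index is the value of `e`;
`digit₁ e` and `digit₂ e` query the digit whose index is the value of `e`. -/
inductive Expr where
  | num (c : ℕ)
  | reg (r : ℕ)
  | get (a : ℕ) (e : Expr)
  | digit₁ (e : Expr)
  | digit₂ (e : Expr)
  | add (e f : Expr)
  | sub (e f : Expr)
  | mul (e f : Expr)
  | div (e f : Expr)

/-- The value of an expression. -/
def Expr.eval (E : Env) (s : State) : Expr → ℕ
  | .num c => c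
  | .reg r => s.reg r
  | .get a e => s.arr a (e.eval E s)
  | .digit₁ e => E.digit₁ (e.eval E s)
  | .digit₂ e => E.digit₂ (e.eval E s)
  | .add e f => e.eval E s + f.eval E s
  | .sub e f => e.eval E s - f.eval E s
  | .mul e f => e.eval E s * f.eval E s
  | .div e f => e.eval E s / f.eval E s

/-- The time needed to evaluate an expression; `Nat.size` is the number of binary digits. -/
def Expr.cost (E : Env) (s : State) : Expr → ℕ
  | .num _ => 1
  | .reg _ => 1
  | .get _ e => e.cost E s + 1
  | .digit₁ e => e.cost E s + 1
  | .digit₂ e => e.cost E s + 1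
  | .add e f => e.cost E s + f.cost E s + 1
  | .sub e f => e.cost E s + f.cost E s + 1
  | .mul e f => e.cost E s + f.cost E s + ((e.eval E s).size + 1) * ((f.eval E s).size + 1)
  | .div e f => e.cost E s + f.cost E s + ((e.eval E s).size + 1) * ((f.eval E s).size + 1)

/-- Programs. `set r e` stores the value of `e` in register `r`; `put a i e` stores the value of `e`
in the cell of array `a` whose index is the value of `i`; `draw a r` draws the next trace, writes it
into the first cells of array `a` and its length into register `r`.
Tests succeed if the value is nonzero. -/
inductive Prog where
  | skip
  | set (r : ℕ) (e : Expr)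
  | put (a : ℕ) (i e : Expr)
  | draw (a r : ℕ)
  | seq (p q : Prog)
  | ite (e : Expr) (p q : Prog)
  | loop (e : Expr) (p : Prog)

/-- Overwrite the first cells of an array by the bits of a string. -/
def writeBits (y : List Bool) (f : ℕ → ℕ) : ℕ → ℕ := fun i =>
  if h : i < y.length then (y[i]).toNat else f i

/-- The state after storing `v` in register `r`. -/
def State.setReg (s : State) (r v : ℕ) : State :=
  { s with reg := Function.update s.reg r v }

/-- The state after storing `v` in cell `i` of array `a`. -/
def State.setCell (s : State) (a i v : ℕ) : State :=
  { s with arr := Function.update s.arr a (Function.update (s.arr a) i v) }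

/-- The state after drawing the trace `y` into array `a`, its length into register `r`. -/
def State.receive (s : State) (a r : ℕ) (y : List Bool) : State :=
  { reg := Function.update s.reg r y.length
    arr := Function.update s.arr a (writeBits y (s.arr a))
    drawn := s.drawn + 1 }

/-- `Exec E p s c t`: in the environment `E`, the program `p` started in state `s` halts in state
`t` after `c` units of time. -/
inductive Exec (E : Env) : Prog → State → ℕ → State → Prop
  | skip (s : State) : Exec E .skip s 1 s
  | set (r : ℕ) (e : Expr) (s : State) :
      Exec E (.set r e) s (e.cost E s + 1) (s.setReg r (e.eval E s))
  | put (a : ℕ) (i e : Expr) (s : State) :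
      Exec E (.put a i e) s (i.cost E s + e.cost E s + 1) (s.setCell a (i.eval E s) (e.eval E s))
  | draw (a r : ℕ) (s : State) :
      Exec E (.draw a r) s ((E.trace s.drawn).length + 1) (s.receive a r (E.trace s.drawn))
  | seq {p q : Prog} {s t u : State} {c d : ℕ} :
      Exec E p s c t → Exec E q t d u → Exec E (.seq p q) s (c + d) u
  | ite_true {e : Expr} {p q : Prog} {s t : State} {c : ℕ} :
      e.eval E s ≠ 0 → Exec E p s c t → Exec E (.ite e p q) s (e.cost E s + 1 + c) t
  | ite_false {e : Expr} {p q : Prog} {s t : State} {c : ℕ} :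
      e.eval E s = 0 → Exec E q s c t → Exec E (.ite e p q) s (e.cost E s + 1 + c) t
  | loop_done {e : Expr} {p : Prog} {s : State} :
      e.eval E s = 0 → Exec E (.loop e p) s (e.cost E s + 1) s
  | loop_step {e : Expr} {p : Prog} {s t u : State} {c d : ℕ} :
      e.eval E s ≠ 0 → Exec E p s c t → Exec E (.loop e p) t d u →
        Exec E (.loop e p) s (e.cost E s + 1 + c + d) u

/-- The machine is deterministic: final state and running time are determined by program,
environment and initial state. -/
theorem Exec.deterministic {E : Env} {p : Prog} {s t t' : State} {c c' : ℕ}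
    (h : Exec E p s c t) (h' : Exec E p s c' t') : c = c' ∧ t = t' := by
  induction h generalizing c' t' with
  | skip | set | put | draw => cases h'; exact ⟨rfl, rfl⟩
  | seq _ _ ih₁ ih₂ =>
    cases h' with
    | seq a b =>
      obtain ⟨rfl, rfl⟩ := ih₁ a
      obtain ⟨rfl, rfl⟩ := ih₂ b
      exact ⟨rfl, rfl⟩
  | ite_true h0 _ ih =>
    cases h' with
    | ite_true _ a => obtain ⟨rfl, rfl⟩ := ih a; exact ⟨rfl, rfl⟩
    | ite_false h1 _ => exact absurd h1 h0
  | ite_false h0 _ ih =>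
    cases h' with
    | ite_true h1 _ => exact absurd h0 h1
    | ite_false _ a => obtain ⟨rfl, rfl⟩ := ih a; exact ⟨rfl, rfl⟩
  | loop_done h0 =>
    cases h' with
    | loop_done _ => exact ⟨rfl, rfl⟩
    | loop_step h1 _ _ => exact absurd h0 h1
  | loop_step h0 _ _ ih₁ ih₂ =>
    cases h' with
    | loop_done h1 => exact absurd h1 h0
    | loop_step _ a b =>
      obtain ⟨rfl, rfl⟩ := ih₁ a
      obtain ⟨rfl, rfl⟩ := ih₂ b
      exact ⟨rfl, rfl⟩

/-- The initial state on input `w` and `n`: `n` in register `0`, the length of `w` in register `1`,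
the bits of `w` in array `0`, zero everywhere else, and no trace drawn yet. -/
def initialState (n : ℕ) (w : List Bool) : State where
  reg := fun r => if r = 0 then n else if r = 1 then w.length else 0
  arr := fun a => if a = 0 then writeBits w (fun _ => 0) else fun _ => 0
  drawn := 0

/-- The environment in which the machine can query the digits of `δ` and of `τ` and draws the
strings `y 0, y 1, …` one after the other. -/
noncomputable def traceEnv (δ τ : ℝ) (y : ℕ → List Bool) : Env where
  digit₁ := binaryDigit δ
  digit₂ := binaryDigit τ
  trace := y

/-!
The multiplicity `#(w, x)` is read off from an unbiased estimator. For a real number `z` let `S_z(y)`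
be the sum, over all embeddings of `w` into `y` as a scattered subword, of `z ^ g`, where `g` is the
number of letters of `y` skipped between the first and the last letter of the embedding
(`occurrenceWeight`); so `S_0(x) = #(w, x)`. A letter of `x` in a gap is deleted with probability `δ`
and otherwise contributes the factor `z` to the trace. Hence, with `k` the length of `w`, the
expectation of `S_z` over a trace of `x` is `(1 - δ) ^ k * S_{z'}(x)` with `z' = δ + (1 - δ) z`
(`integral_occurrenceWeight`), and `z = -δ / (1 - δ)` makes `z'` vanish. For `δ < 1 / 2` this `z` has
absolute value less than `1`, so each of the `k - 1` gaps contributes at most a geometric series and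
`|S_z| ≤ n ((1 - δ) / (1 - 2 δ)) ^ (k - 1)` (`abs_occurrenceWeight_le`). By Hoeffding's inequality,
averaging over polynomially many traces in `n`, `(1 / 2 - δ) ^ (-k)` and `ln (2 / τ)` determines
`#(w, x)` by rounding.

The machine replaces `δ` by a truncation `a / Q` with `64 n² ≤ Q`, and `z` by `-a / b` with
`b = Q - a`. The resulting bias is at most `1 / 16` (`abs_pow_mul_occurrenceWeight_sub_le`), and the
estimator is within `1 / 2` of the multiplicity with probability at least `1 - τ`
(`le_measureReal_estimator`). A lower bound `1 / G` for `1 - 2 δ` and the order of magnitude of `τ`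
are read off from the digits (`exists_precision`, `exists_confidence`).

On one trace, `b ^ n * S_z` is computed exactly by dynamic programming over the suffixes of the word
and of the trace. Since `z` is negative, an integer is stored as a pair of natural numbers
(`Represents`), whose sum stays below `n * Q ^ n`; this bounds the bit cost of every multiplication
inside the loop over the traces. The accumulated sums, which also depend on the number of traces,
enter a product only once, at the end, so that the running time is linear in `ln (2 / τ)`
(`runs_countOccurrences`, `resources_le`).
-/

/-! ### Weighted embeddings of a word -/

/-- The sum, over all embeddings of `w` into `y` as a scattered subword, of `z ^ g`, where `g` is the
number of letters of `y` skipped before the last letter of the embedding. -/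
noncomputable def gapWeight (z : ℝ) : List Bool → List Bool → ℝ
  | [], _ => 1
  | _ :: _, [] => 0
  | c :: w, b :: y => (if b = c then gapWeight z w y else 0) + z * gapWeight z (c :: w) y

/-- The sum, over all embeddings of `c :: w` into `y`, of `z ^ g`, where `g` is the number of letters
of `y` skipped between the first and the last letter of the embedding. -/
noncomputable def occurrenceWeight (z : ℝ) (c : Bool) (w : List Bool) : List Bool → ℝ
  | [] => 0
  | b :: y => (if b = c then gapWeight z w y else 0) + occurrenceWeight z c w y

@[simp] theorem gapWeight_nil (z : ℝ) (y : List Bool) : gapWeight z [] y = 1 := by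
  cases y <;> simp [gapWeight]

/-- The recursion along the positions of `y`; beyond the end of `y` all terms vanish. -/
theorem gapWeight_cons_drop (z : ℝ) (c : Bool) (w y : List Bool) (t : ℕ) :
    gapWeight z (c :: w) (y.drop t) =
      (if y[t]? = some c then gapWeight z w (y.drop (t + 1)) else 0) +
        z * gapWeight z (c :: w) (y.drop (t + 1)) := by
  rcases lt_or_ge t y.length with h | h
  · rw [List.drop_eq_getElem_cons h, gapWeight]
    simp [List.getElem?_eq_getElem h]
  · simp [List.drop_eq_nil_of_le h, List.drop_eq_nil_of_le (h.trans (Nat.le_succ t)), gapWeight, h]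

theorem occurrenceWeight_drop (z : ℝ) (c : Bool) (w y : List Bool) (t : ℕ) :
    occurrenceWeight z c w (y.drop t) =
      (if y[t]? = some c then gapWeight z w (y.drop (t + 1)) else 0) +
        occurrenceWeight z c w (y.drop (t + 1)) := by
  rcases lt_or_ge t y.length with h | h
  · rw [List.drop_eq_getElem_cons h, occurrenceWeight]
    simp [List.getElem?_eq_getElem h]
  · simp [List.drop_eq_nil_of_le h, List.drop_eq_nil_of_le (h.trans (Nat.le_succ t)),
      occurrenceWeight, h]

/-- Every gap contributes at most a geometric series, whose sum is bounded by `r`. -/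
theorem abs_gapWeight_le {z r : ℝ} (hr : 0 ≤ r) (h : 1 + |z| * r ≤ r) (w y : List Bool) :
    |gapWeight z w y| ≤ r ^ w.length := by
  induction y generalizing w with
  | nil => cases w <;> simp [gapWeight]; positivity
  | cons b y ih =>
    cases w with
    | nil => simp
    | cons c w =>
      have h1 : |if b = c then gapWeight z w y else 0| ≤ r ^ w.length := by
        split_ifs
        · exact ih w
        · simpa using pow_nonneg hr _
      calc |gapWeight z (c :: w) (b :: y)|
          ≤ |if b = c then gapWeight z w y else 0| + |z| * |gapWeight z (c :: w) y| := by
            rw [gapWeight, ← abs_mul]; exact abs_add_le _ _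
        _ ≤ r ^ w.length + |z| * r ^ (w.length + 1) := by gcongr; exact ih _
        _ = r ^ w.length * (1 + |z| * r) := by ring
        _ ≤ r ^ w.length * r := by gcongr
        _ = r ^ (c :: w).length := by rw [List.length_cons, pow_succ]

theorem abs_occurrenceWeight_le {z r : ℝ} (hr : 0 ≤ r) (h : 1 + |z| * r ≤ r) (c : Bool)
    (w y : List Bool) : |occurrenceWeight z c w y| ≤ y.length * r ^ w.length := by
  induction y with
  | nil => simp [occurrenceWeight]
  | cons b y ih =>
    have h1 : |if b = c then gapWeight z w y else 0| ≤ r ^ w.length := by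
      split_ifs
      · exact abs_gapWeight_le hr h w y
      · simpa using pow_nonneg hr _
    calc |occurrenceWeight z c w (b :: y)| ≤ _ + _ := by rw [occurrenceWeight]; exact abs_add_le _ _
      _ ≤ r ^ w.length + y.length * r ^ w.length := add_le_add h1 ih
      _ = (b :: y).length * r ^ w.length := by push_cast [List.length_cons]; ring

theorem gapWeight_nonneg {z : ℝ} (hz : 0 ≤ z) (w y : List Bool) : 0 ≤ gapWeight z w y := by
  induction y generalizing w with
  | nil => cases w <;> simp [gapWeight]
  | cons b y ih =>
    cases w with
    | nil => simp
    | cons c w =>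
      have := ih w
      have := mul_nonneg hz (ih (c :: w))
      rw [gapWeight]; split_ifs <;> linarith

theorem gapWeight_zero (w y : List Bool) : gapWeight 0 w y = if w <+: y then 1 else 0 := by
  induction y generalizing w with
  | nil => cases w <;> simp [gapWeight]
  | cons b y ih =>
    cases w with
    | nil => simp
    | cons c w =>
      rw [gapWeight, ih]
      by_cases hb : b = c
      · simp [hb, List.cons_prefix_cons]
      · simp [hb, List.cons_prefix_cons, Ne.symm hb]

theorem gapWeight_zero_le {z : ℝ} (hz : 0 ≤ z) (w y : List Bool) :
    gapWeight 0 w y ≤ gapWeight z w y := by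
  induction y generalizing w with
  | nil => cases w <;> simp [gapWeight]
  | cons b y ih =>
    cases w with
    | nil => simp
    | cons c w =>
      have := ih w
      have := mul_nonneg hz (gapWeight_nonneg hz (c :: w) y)
      rw [gapWeight, gapWeight]; split_ifs <;> linarith

/-- For small `z ≥ 0` the embeddings that skip letters contribute at most `r ^ |w| - 1`, where
`r = 1 / (1 - z)`: the full geometric series without its leading term. -/
theorem gapWeight_le_zero_add {z r : ℝ} (hz : 0 ≤ z) (hr : 1 ≤ r) (h : 1 + z * r = r)
    (w y : List Bool) : gapWeight z w y ≤ gapWeight 0 w y + (r ^ w.length - 1) := by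
  induction y generalizing w with
  | nil =>
    cases w with
    | nil => simp
    | cons c w => simpa [gapWeight] using one_le_pow₀ hr
  | cons b y ih =>
    cases w with
    | nil => simp
    | cons c w =>
      have h1 := ih w
      have h2 : z * gapWeight z (c :: w) y ≤ z * r ^ (w.length + 1) := by
        refine mul_le_mul_of_nonneg_left ?_ hz
        refine (le_abs_self _).trans (abs_gapWeight_le (by linarith) ?_ (c :: w) y)
        rw [abs_of_nonneg hz, h]
      have h3 : z * r ^ (w.length + 1) = r ^ (w.length + 1) - r ^ w.length := by
        rw [pow_succ]; linear_combination r ^ w.length * h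
      have h4 : 1 ≤ r ^ w.length := one_le_pow₀ hr
      rw [gapWeight, gapWeight, List.length_cons]
      split_ifs <;> linarith

theorem occurrenceWeight_zero_le {z : ℝ} (hz : 0 ≤ z) (c : Bool) (w y : List Bool) :
    occurrenceWeight 0 c w y ≤ occurrenceWeight z c w y := by
  induction y with
  | nil => simp [occurrenceWeight]
  | cons b y ih =>
    have := gapWeight_zero_le hz w y
    rw [occurrenceWeight, occurrenceWeight]; split_ifs <;> linarith

theorem occurrenceWeight_le_zero_add {z r : ℝ} (hz : 0 ≤ z) (hr : 1 ≤ r) (h : 1 + z * r = r)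
    (c : Bool) (w y : List Bool) :
    occurrenceWeight z c w y ≤ occurrenceWeight 0 c w y + y.length * (r ^ w.length - 1) := by
  induction y with
  | nil => simp [occurrenceWeight]
  | cons b y ih =>
    have := gapWeight_le_zero_add hz hr h w y
    have : 1 ≤ r ^ w.length := one_le_pow₀ hr
    rw [occurrenceWeight, occurrenceWeight, List.length_cons]
    push_cast
    split_ifs <;> linarith

/-- An occurrence of `w` in `b :: x` is a prefix of `b :: x` or an occurrence in `x`. -/
theorem subwordMultiplicity_cons (w : List Bool) (hw : w ≠ []) (b : Bool) (x : List Bool) :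
    subwordMultiplicity w (b :: x) =
      (if w <+: b :: x then 1 else 0) + subwordMultiplicity w x := by
  have hpos : 0 < w.length := List.length_pos_iff.2 hw
  unfold subwordMultiplicity subwordDeck
  rcases lt_or_ge x.length w.length with h | h
  · rcases (Nat.succ_le_of_lt h).lt_or_eq with h' | h'
    · have h1 : (b :: x).length + 1 - w.length = 0 := by simp; omega
      have h2 : x.length + 1 - w.length = 0 := by omega
      have h3 : ¬ w <+: b :: x := fun hp => by have := hp.length_le; simp at this; omega
      rw [h1, h2]; simp [h3]
    · have h1 : (b :: x).length + 1 - w.length = 1 := by simp; omega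
      have h2 : x.length + 1 - w.length = 0 := by omega
      rw [h1, h2]
      simp only [List.prefix_iff_eq_take]
      simp [Multiset.range_succ, Multiset.count_singleton]
  · have h1 : (b :: x).length + 1 - w.length = (x.length + 1 - w.length) + 1 := by simp; omega
    have h2 : Multiset.range ((x.length + 1 - w.length) + 1) =
        0 ::ₘ (Multiset.range (x.length + 1 - w.length)).map Nat.succ := by
      rw [← Multiset.coe_range, List.range_succ_eq_map]; rfl
    simp only [List.prefix_iff_eq_take]
    rw [h1, h2, Multiset.map_cons, Multiset.map_map, Multiset.count_cons,
      add_comm]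
    rfl

theorem occurrenceWeight_zero (c : Bool) (w x : List Bool) :
    occurrenceWeight 0 c w x = subwordMultiplicity (c :: w) x := by
  induction x with
  | nil => simp [occurrenceWeight, subwordMultiplicity, subwordDeck]
  | cons b x ih =>
    rw [occurrenceWeight, subwordMultiplicity_cons _ (by simp), ih, gapWeight_zero]
    by_cases hb : b = c
    · simp [hb, List.cons_prefix_cons]
    · simp [hb, List.cons_prefix_cons, Ne.symm hb]

theorem subwordMultiplicity_le_length (w : List Bool) (hw : w ≠ []) (x : List Bool) :
    subwordMultiplicity w x ≤ x.length := by
  have hpos : 0 < w.length := List.length_pos_iff.2 hw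
  refine (Multiset.count_le_card _ _).trans ?_
  simp [subwordDeck]; omega

/-! ### Expectations under the deletion channel -/

theorem length_le_of_mem_support_deletionChannel {δ : unitInterval} {x y : List Bool}
    (h : y ∈ (deletionChannel δ x).support) : y.length ≤ x.length := by
  induction x generalizing y with
  | nil => simp [deletionChannel] at h; simp [h]
  | cons b x ih =>
    simp only [deletionChannel, PMF.mem_support_bind_iff, PMF.support_map, Set.mem_image] at h
    obtain ⟨d, -, z, hz, rfl⟩ := h
    have := ih hz
    split_ifs <;> simp <;> omega

/-- The trace of `b :: x` is a mixture: with probability `δ` it is a trace of `x`, and otherwise it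
is `b` followed by a trace of `x`. -/
theorem toMeasure_deletionChannel_cons (δ : unitInterval) (b : Bool) (x : List Bool) :
    (deletionChannel δ (b :: x)).toMeasure =
      unitInterval.toNNReal δ • (deletionChannel δ x).toMeasure +
        (1 - unitInterval.toNNReal δ) •
          (deletionChannel δ x).toMeasure.map (fun y => b :: y) := by
  ext s hs
  have hm : Measurable (fun y : List Bool => b :: y) := fun _ _ => trivial
  rw [deletionChannel, PMF.toMeasure_bind_apply _ _ _ hs, tsum_bool]
  simp only [Measure.add_apply, Measure.smul_apply]
  have hmap : ∀ f : List Bool → List Bool, ((deletionChannel δ x).map f).toMeasure s =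
      (deletionChannel δ x).toMeasure (f ⁻¹' s) := fun f =>
    PMF.toMeasure_map_apply f _ s (fun _ _ => trivial) hs
  rw [hmap, hmap, Measure.map_apply hm hs, add_comm]
  have hber : ∀ d, PMF.bernoulli (unitInterval.toNNReal δ) δ.2.2 d =
      ((bif d then unitInterval.toNNReal δ else 1 - unitInterval.toNNReal δ : NNReal) : ENNReal) :=
    fun d => PMF.bernoulli_apply _ d
  rw [hber, hber]
  simp [ENNReal.smul_def]

theorem measurable_of_list (f : List Bool → ℝ) : Measurable f := fun _ _ => trivial

/-- The law of a trace is finitely supported, so that every statistic of a trace is integrable. -/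
theorem integrable_deletionChannel (δ : unitInterval) (x : List Bool) (f : List Bool → ℝ) :
    Integrable f (deletionChannel δ x).toMeasure := by
  induction x generalizing f with
  | nil =>
    rw [deletionChannel, PMF.toMeasure_pure]
    exact integrable_dirac (by simp)
  | cons b x ih =>
    rw [toMeasure_deletionChannel_cons]
    refine ((ih f).smul_measure_nnreal).add_measure (Integrable.smul_measure_nnreal ?_)
    have hm : AEMeasurable (fun y : List Bool => b :: y) (deletionChannel δ x).toMeasure :=
      Measurable.aemeasurable fun _ _ => trivial
    rw [integrable_map_measure (measurable_of_list f).aestronglyMeasurable hm]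
    exact ih _

theorem integral_deletionChannel_nil (δ : unitInterval) (f : List Bool → ℝ) :
    ∫ y, f y ∂(deletionChannel δ []).toMeasure = f [] := by
  rw [deletionChannel, PMF.toMeasure_pure, integral_dirac]

theorem integral_deletionChannel_cons (δ : unitInterval) (b : Bool) (x : List Bool)
    (f : List Bool → ℝ) :
    ∫ y, f y ∂(deletionChannel δ (b :: x)).toMeasure =
      δ * ∫ y, f y ∂(deletionChannel δ x).toMeasure +
        (1 - δ) * ∫ y, f (b :: y) ∂(deletionChannel δ x).toMeasure := by
  have hm : AEMeasurable (fun y : List Bool => b :: y) (deletionChannel δ x).toMeasure :=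
    Measurable.aemeasurable fun _ _ => trivial
  have hf : Integrable f ((deletionChannel δ x).toMeasure.map (fun y => b :: y)) := by
    rw [integrable_map_measure (measurable_of_list f).aestronglyMeasurable hm]
    exact integrable_deletionChannel _ _ _
  rw [toMeasure_deletionChannel_cons, integral_add_measure
    ((integrable_deletionChannel _ _ _).smul_measure_nnreal) hf.smul_measure_nnreal,
    integral_smul_nnreal_measure, integral_smul_nnreal_measure,
    integral_map hm (measurable_of_list f).aestronglyMeasurable]
  have h1 : unitInterval.toNNReal δ ≤ 1 := δ.2.2
  simp only [NNReal.smul_def, NNReal.coe_sub h1, smul_eq_mul]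
  simp [unitInterval.coe_toNNReal]

/-- A letter of `x` that lies in a gap is deleted with probability `δ`, and otherwise survives and
contributes the factor `z`. -/
theorem integral_gapWeight (δ : unitInterval) (z : ℝ) (w x : List Bool) :
    ∫ y, gapWeight z w y ∂(deletionChannel δ x).toMeasure =
      (1 - δ) ^ w.length * gapWeight (δ + (1 - δ) * z) w x := by
  induction x generalizing w with
  | nil => rw [integral_deletionChannel_nil]; cases w <;> simp [gapWeight]
  | cons b x ih =>
    cases w with
    | nil => simp
    | cons c w =>
      rw [integral_deletionChannel_cons]
      simp only [gapWeight]
      rw [integral_add (integrable_deletionChannel _ _ _) (integrable_deletionChannel _ _ _),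
        integral_const_mul, ih]
      have : ∫ y, (if b = c then gapWeight z w y else 0) ∂(deletionChannel δ x).toMeasure =
          if b = c then (1 - (δ : ℝ)) ^ w.length * gapWeight (δ + (1 - δ) * z) w x else 0 := by
        split_ifs
        · exact ih w
        · simp
      rw [this, List.length_cons]
      split_ifs <;> ring

theorem integral_occurrenceWeight (δ : unitInterval) (z : ℝ) (c : Bool) (w x : List Bool) :
    ∫ y, occurrenceWeight z c w y ∂(deletionChannel δ x).toMeasure =
      (1 - δ) ^ (w.length + 1) * occurrenceWeight (δ + (1 - δ) * z) c w x := by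
  induction x with
  | nil => rw [integral_deletionChannel_nil]; simp [occurrenceWeight]
  | cons b x ih =>
    rw [integral_deletionChannel_cons]
    simp only [occurrenceWeight]
    rw [integral_add (integrable_deletionChannel _ _ _) (integrable_deletionChannel _ _ _), ih]
    have : ∫ y, (if b = c then gapWeight z w y else 0) ∂(deletionChannel δ x).toMeasure =
        if b = c then (1 - (δ : ℝ)) ^ w.length * gapWeight (δ + (1 - δ) * z) w x else 0 := by
      split_ifs
      · exact integral_gapWeight δ z w x
      · simp
    rw [this]
    split_ifs <;> ring

/-! ### Concentration of empirical means -/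

instance (δ : unitInterval) (x : List Bool) : IsProbabilityMeasure (traceStream δ x) := by
  unfold traceStream; infer_instance

theorem ae_mem_support_traceStream (δ : unitInterval) (x : List Bool) :
    ∀ᵐ y ∂traceStream δ x, ∀ i, y i ∈ (deletionChannel δ x).support := by
  rw [ae_all_iff]
  intro i
  have h : ∀ᵐ u ∂(deletionChannel δ x).toMeasure, u ∈ (deletionChannel δ x).support := by
    rw [ae_iff]
    have hs : MeasurableSet {u | ¬ u ∈ (deletionChannel δ x).support} := trivial
    refine (PMF.toMeasure_apply_eq_zero_iff _ hs).2 ?_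
    exact Set.disjoint_left.2 fun u hu hu' => hu' hu
  have hp : MeasurePreserving (fun y : ℕ → List Bool => y i) (traceStream δ x)
      (deletionChannel δ x).toMeasure :=
    measurePreserving_eval_infinitePi (fun _ : ℕ => (deletionChannel δ x).toMeasure) i
  exact hp.quasiMeasurePreserving.ae h

theorem one_sided_hoeffding (δ : unitInterval) (x : List Bool) (f : List Bool → ℝ) {H : ℝ}
    (hf : ∀ y ∈ (deletionChannel δ x).support, |f y| ≤ H) (T : ℕ) {ε : ℝ} (hε : 0 ≤ ε) :
    (traceStream δ x).real {y | ε ≤ ∑ i ∈ Finset.range T,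
      (f (y i) - ∫ u, f u ∂(deletionChannel δ x).toMeasure)} ≤
      Real.exp (-ε ^ 2 / (2 * T * H ^ 2)) := by
  set e := ∫ u, f u ∂(deletionChannel δ x).toMeasure with he
  have hind : iIndepFun (fun (i : ℕ) (y : ℕ → List Bool) => f (y i) - e) (traceStream δ x) :=
    iIndepFun_infinitePi (P := fun _ : ℕ => (deletionChannel δ x).toMeasure)
      (X := fun _ u => f u - e) (fun _ => measurable_of_list _)
  have hsub : ∀ i : ℕ, HasSubgaussianMGF (fun y : ℕ → List Bool => f (y i) - e)
      ((‖H - -H‖₊ / 2) ^ 2) (traceStream δ x) := by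
    intro i
    have hp : MeasurePreserving (fun y : ℕ → List Bool => y i) (traceStream δ x)
        (deletionChannel δ x).toMeasure :=
      measurePreserving_eval_infinitePi (fun _ : ℕ => (deletionChannel δ x).toMeasure) i
    have hm : Measurable (fun y : ℕ → List Bool => f (y i)) :=
      (measurable_of_list f).comp (measurable_pi_apply i)
    have hi : ∫ y, f (y i) ∂traceStream δ x = e := by
      rw [he, ← hp.map_eq, integral_map hp.aemeasurable
        (measurable_of_list f).aestronglyMeasurable]
    rw [← hi]
    refine hasSubgaussianMGF_of_mem_Icc hm.aemeasurable ?_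
    filter_upwards [ae_mem_support_traceStream δ x] with y hy
    exact abs_le.1 (hf _ (hy i))
  have := HasSubgaussianMGF.measure_sum_range_ge_le_of_iIndepFun hind (n := T)
    (fun i _ => hsub i) hε
  refine this.trans_eq ?_
  -- Hoeffding's lemma has the variance proxy `(‖H - (-H)‖ / 2) ^ 2`.
  congr 2
  have : (((‖H - -H‖₊ / 2) ^ 2 : NNReal) : ℝ) = H ^ 2 := by
    push_cast
    rw [Real.norm_eq_abs, div_pow, sq_abs]; ring
  rw [this]

/-- Two-sided Hoeffding bound for the mean of a bounded statistic over independent traces. -/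
theorem le_measureReal_abs_sum_sub_lt (δ : unitInterval) (x : List Bool) (f : List Bool → ℝ)
    {H : ℝ} (hf : ∀ y ∈ (deletionChannel δ x).support, |f y| ≤ H) (T : ℕ) {ε : ℝ} (hε : 0 ≤ ε) :
    1 - 2 * Real.exp (-ε ^ 2 / (2 * T * H ^ 2)) ≤
      (traceStream δ x).real {y | (∀ i, y i ∈ (deletionChannel δ x).support) ∧
        |∑ i ∈ Finset.range T, f (y i) - T * ∫ u, f u ∂(deletionChannel δ x).toMeasure| < ε} := by
  set e := ∫ u, f u ∂(deletionChannel δ x).toMeasure with he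
  set A := {y : ℕ → List Bool | ε ≤ ∑ i ∈ Finset.range T, (f (y i) - e)}
  set B := {y : ℕ → List Bool | ε ≤ ∑ i ∈ Finset.range T, (-f (y i) - -e)}
  set S := {y : ℕ → List Bool | ¬ ∀ i, y i ∈ (deletionChannel δ x).support}
  set D := {y : ℕ → List Bool | (∀ i, y i ∈ (deletionChannel δ x).support) ∧
        |∑ i ∈ Finset.range T, f (y i) - T * e| < ε}
  have hA : (traceStream δ x).real A ≤ _ := one_sided_hoeffding δ x f hf T hε
  have hB : (traceStream δ x).real B ≤ Real.exp (-ε ^ 2 / (2 * T * H ^ 2)) := by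
    have := one_sided_hoeffding δ x (fun y => -f y) (H := H) (by simpa using hf) T hε
    rw [integral_neg] at this
    exact this
  have hS : (traceStream δ x).real S = 0 := by
    rw [measureReal_def, (ae_iff.1 (ae_mem_support_traceStream δ x))]; simp
  have hcov : Set.univ ⊆ D ∪ (S ∪ (A ∪ B)) := by
    intro y _
    by_cases h : y ∈ S
    · exact Or.inr (Or.inl h)
    by_cases hA' : y ∈ A
    · exact Or.inr (Or.inr (Or.inl hA'))
    by_cases hB' : y ∈ B
    · exact Or.inr (Or.inr (Or.inr hB'))
    refine Or.inl ⟨by simpa [S] using h, ?_⟩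
    simp only [A, B, Set.mem_ofPred_eq, not_le, Finset.sum_sub_distrib, Finset.sum_const,
      Finset.card_range, nsmul_eq_mul, Finset.sum_neg_distrib] at hA' hB'
    rw [abs_lt]
    constructor <;> linarith
  have h1 := measureReal_mono (μ := traceStream δ x) hcov
  rw [probReal_univ] at h1
  have h2 := measureReal_union_le (μ := traceStream δ x) D (S ∪ (A ∪ B))
  have h3 := measureReal_union_le (μ := traceStream δ x) S (A ∪ B)
  have h4 := measureReal_union_le (μ := traceStream δ x) A B
  linarith

/-! ### The estimator -/

/-- Writing `ε = δ + (1 - δ) z` for the error left by a rational approximation `z` of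
`-δ / (1 - δ)`, and `q` for the resulting error in the normalization, the expectation of the
estimator differs from the multiplicity by at most `1 / 16`. -/
theorem abs_pow_mul_occurrenceWeight_sub_le {n : ℕ} {q ε θ : ℝ} (hq : q ≤ 1) (hq' : 1 - θ ≤ q)
    (hε : 0 ≤ ε) (hεθ : ε ≤ θ) (hθ : 32 * (n : ℝ) ^ 2 * θ ≤ 1) (c : Bool) (w x : List Bool)
    (hx : x.length = n) (hw : w.length + 1 ≤ n) :
    |q ^ (w.length + 1) * occurrenceWeight ε c w x - subwordMultiplicity (c :: w) x| ≤ 1 / 16 := by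
  have hn : (1 : ℝ) ≤ n := by exact_mod_cast (by omega : 1 ≤ n)
  have hk : ((w.length : ℝ) + 1) ≤ n := by exact_mod_cast hw
  have hl : (0 : ℝ) ≤ w.length := Nat.cast_nonneg _
  have hθ0 : 0 ≤ θ := hε.trans hεθ
  -- `η` bounds the relative errors of the normalization and of the geometric series.
  set η : ℝ := 1 / (32 * n) with hη
  have hη0 : 0 < η := by positivity
  have hnη : n * η = 1 / 32 := by rw [hη]; field_simp
  have hnθ : n * θ ≤ η := by
    rw [hη, le_div_iff₀ (by positivity)]; nlinarith
  have hη1 : η ≤ 1 / 32 := by rw [← hnη]; nlinarith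
  have hθ1 : θ ≤ 1 / 32 := by nlinarith
  have hμ : (subwordMultiplicity (c :: w) x : ℝ) ≤ n := by
    exact_mod_cast hx ▸ subwordMultiplicity_le_length (c :: w) (by simp) x
  have hμ0 : (0 : ℝ) ≤ subwordMultiplicity (c :: w) x := Nat.cast_nonneg _
  rw [← occurrenceWeight_zero] at *
  set μ := occurrenceWeight 0 c w x
  have h1 : μ ≤ occurrenceWeight ε c w x := occurrenceWeight_zero_le hε c w x
  have hr : 1 ≤ (1 - ε)⁻¹ := (one_le_inv₀ (by linarith)).2 (by linarith)
  have hne : 1 - ε ≠ 0 := by linarith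
  have h2 := occurrenceWeight_le_zero_add hε hr (by field_simp; ring) c w x
  rw [hx] at h2
  have h3 : 1 - η ≤ (1 - ε) ^ w.length := by
    have := one_add_mul_le_pow (a := -ε) (by linarith) w.length
    have h : (w.length : ℝ) * ε ≤ n * θ := by gcongr; linarith
    rw [← sub_eq_add_neg] at this
    linarith
  have h4 : (1 - ε)⁻¹ ^ w.length ≤ 1 + 2 * η := by
    rw [inv_pow]
    calc ((1 - ε) ^ w.length)⁻¹ ≤ (1 - η)⁻¹ := by
          apply inv_anti₀ (by linarith) h3
      _ ≤ 1 + 2 * η := by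
          rw [inv_le_iff_one_le_mul₀ (by linarith)]; nlinarith
  have h5 : occurrenceWeight ε c w x ≤ μ + 1 / 16 := by
    have : (n : ℝ) * ((1 - ε)⁻¹ ^ w.length - 1) ≤ n * (2 * η) := by gcongr; linarith
    linarith
  have h6 : 1 - η ≤ q ^ (w.length + 1) := by
    have := one_add_mul_le_pow (a := q - 1) (by linarith) (w.length + 1)
    have h : ((w.length : ℝ) + 1) * (1 - q) ≤ n * θ := by (gcongr; linarith)
    push_cast at this
    rw [add_sub_cancel] at this
    linarith
  have h7 : q ^ (w.length + 1) ≤ 1 := pow_le_one₀ (by linarith) hq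
  have h8 : (1 - η) * μ ≤ q ^ (w.length + 1) * occurrenceWeight ε c w x := by
    gcongr
    linarith
  have h9 : q ^ (w.length + 1) * occurrenceWeight ε c w x ≤ 1 * (μ + 1 / 16) := by
    gcongr
    linarith
  have h10 : η * μ ≤ n * η := by nlinarith
  rw [abs_le]
  constructor <;> nlinarith

/-- With `z = -a / b ≈ -δ / (1 - δ)`, the rescaled sum of occurrence weights over
`T = 128 n² G²ᵏ (M + 1)` traces is within `T / 2` of `T` times the multiplicity, except with
probability `2 exp (-(M + 1)) ≤ τ`. -/
theorem le_measureReal_estimator (δ : unitInterval) (hδ : (δ : ℝ) < 1 / 2) {τ : ℝ} (hτ : 0 < τ)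
    {n a b G M T : ℕ} (c : Bool) (w x : List Bool) (hx : x.length = n) (hw : w.length + 1 ≤ n)
    (ha : (a : ℝ) ≤ (δ : ℝ) * (a + b : ℕ)) (ha' : (δ : ℝ) * (a + b : ℕ) < (a : ℝ) + 1)
    (hQ : 64 * n ^ 2 ≤ a + b) (hG : 1 ≤ (1 - 2 * (δ : ℝ)) * G)
    (hM : Real.log (2 / τ) ≤ M + 1)
    (hT : T = 128 * n ^ 2 * G ^ (2 * (w.length + 1)) * (M + 1)) :
    1 - τ ≤ (traceStream δ x).real {y | (∀ i, y i ∈ (deletionChannel δ x).support) ∧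
      |((a + b : ℕ) / b : ℝ) ^ (w.length + 1) *
          ∑ i ∈ Finset.range T, occurrenceWeight (-(a / b : ℝ)) c w (y i) -
        T * subwordMultiplicity (c :: w) x| < T / 2} := by
  set Q : ℝ := ((a + b : ℕ) : ℝ) with hQd
  have hQab : Q = a + b := by rw [hQd]; push_cast; rfl
  set μ : ℝ := (subwordMultiplicity (c :: w) x : ℝ)
  set k := w.length + 1 with hk
  have hδ0 : 0 ≤ (δ : ℝ) := δ.2.1
  have ha0 : (0 : ℝ) ≤ a := Nat.cast_nonneg _
  have hb0' : (0 : ℝ) ≤ b := Nat.cast_nonneg _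
  have hn : (1 : ℝ) ≤ n := by exact_mod_cast (by omega : 1 ≤ n)
  have hQ' : 64 * (n : ℝ) ^ 2 ≤ Q := by rw [hQd]; exact_mod_cast hQ
  have hQ0 : 0 < Q := by nlinarith
  have hδQ : Q * (1 - δ) = Q - δ * Q := by ring
  have hδQ2 : δ * Q ≤ 1 / 2 * Q := by gcongr
  have hb2 : Q / 2 ≤ b := by linarith
  have hb0 : 0 < (b : ℝ) := by linarith
  have hba : Q * (1 - 2 * δ) ≤ b - a := by linarith
  have hba0 : 0 < (b : ℝ) - a := lt_of_lt_of_le (mul_pos hQ0 (by linarith)) hba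
  have hG0 : (0 : ℝ) ≤ G := Nat.cast_nonneg _
  have hG1 : (1 : ℝ) ≤ G := by nlinarith
  set z : ℝ := -(a / b : ℝ) with hz
  set f : List Bool → ℝ := fun y => (Q / b) ^ k * occurrenceWeight z c w y with hf
  -- Each gap costs a factor `b / (b - a)` and each letter a factor `Q / b`; together `Q / (b - a)`,
  -- which is at most `1 / (1 - 2 δ) ≤ G`.
  set H : ℝ := 2 * n * (G : ℝ) ^ k with hH
  have hH0 : 0 < H := by positivity
  have hbound : ∀ y ∈ (deletionChannel δ x).support, |f y| ≤ H := by
    intro y hy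
    have hlen : (y.length : ℝ) ≤ n := by
      exact_mod_cast hx ▸ length_le_of_mem_support_deletionChannel hy
    have h1 := abs_occurrenceWeight_le (z := z) (r := b / (b - a)) (by positivity)
      (by rw [hz, abs_neg, abs_of_nonneg (by positivity)]; apply le_of_eq; field_simp; ring) c w y
    have h2 : Q / b ≤ 2 := by rw [div_le_iff₀ hb0]; linarith
    have h3 : Q / (b - a) ≤ G := by
      rw [div_le_iff₀ hba0]
      calc Q = Q * 1 := by ring
        _ ≤ Q * ((1 - 2 * δ) * G) := by gcongr
        _ = G * (Q * (1 - 2 * δ)) := by ring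
        _ ≤ G * (b - a) := by gcongr
    calc |f y| = (Q / b) ^ k * |occurrenceWeight z c w y| := by
          rw [hf, abs_mul, abs_of_nonneg (by positivity)]
      _ ≤ (Q / b) ^ k * (n * (b / (b - a)) ^ w.length) := by
          gcongr; exact h1.trans (by gcongr)
      _ = (Q / b) * n * (Q / (b - a)) ^ w.length := by
          rw [hk, pow_succ]
          rw [show Q / (b - a) = Q / b * (b / (b - a)) by field_simp, mul_pow]; ring
      _ ≤ 2 * n * (G : ℝ) ^ w.length := by gcongr
      _ ≤ H := by rw [hH]; gcongr; omega
  -- A deviation of `T / 4` makes the Hoeffding exponent equal to `-(M + 1)`; the bias `1 / 16` leaves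
  -- the total error below `T / 2`.
  have hTr : (T : ℝ) = 32 * (M + 1) * H ^ 2 := by
    rw [hT, hH]; push_cast; ring
  have hT0 : 0 < (T : ℝ) := by rw [hTr]; positivity
  have hmain := le_measureReal_abs_sum_sub_lt δ x f hbound T (ε := T / 4) (by positivity)
  have hexp : 2 * Real.exp (-((T : ℝ) / 4) ^ 2 / (2 * T * H ^ 2)) ≤ τ := by
    have h1 : -((T : ℝ) / 4) ^ 2 / (2 * T * H ^ 2) = -((M : ℝ) + 1) := by
      rw [hTr]; field_simp; ring
    have h2 : Real.exp (-((M : ℝ) + 1)) ≤ Real.exp (-Real.log (2 / τ)) :=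
      Real.exp_le_exp.2 (by linarith)
    rw [Real.exp_neg (Real.log _), Real.exp_log (by positivity)] at h2
    rw [h1]
    calc 2 * Real.exp (-((M : ℝ) + 1)) ≤ 2 * (2 / τ)⁻¹ := by gcongr
      _ = τ := by field_simp
  have hmean : |∫ u, f u ∂(deletionChannel δ x).toMeasure - μ| ≤ 1 / 16 := by
    rw [hf, integral_const_mul, integral_occurrenceWeight, ← mul_assoc, ← mul_pow]
    refine abs_pow_mul_occurrenceWeight_sub_le (n := n) (θ := 2 / Q) ?_ ?_ ?_ ?_ ?_ c w x hx hw
    · rw [div_mul_eq_mul_div, div_le_one hb0]; linarith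
    · have : 1 / (b : ℝ) ≤ 2 / Q := by
        rw [div_le_div_iff₀ hb0 hQ0]; linarith
      have h2 : 1 - 1 / (b : ℝ) ≤ Q / b * (1 - δ) := by
        rw [div_mul_eq_mul_div, one_sub_div hb0.ne']; gcongr; linarith
      linarith
    · have : (δ : ℝ) + (1 - δ) * z = (δ * Q - a) / b := by
        rw [hz, hQab]; field_simp; ring
      rw [this]; exact div_nonneg (by linarith) hb0'
    · have : (δ : ℝ) + (1 - δ) * z = (δ * Q - a) / b := by
        rw [hz, hQab]; field_simp; ring
      rw [this, div_le_div_iff₀ hb0 hQ0]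
      have : (δ * Q - a) * Q ≤ 1 * Q := by gcongr; linarith
      linarith
    · rw [mul_div_assoc', div_le_one hQ0]; linarith
  refine le_trans (by linarith) (hmain.trans (measureReal_mono ?_))
  rintro y ⟨hy, hy'⟩
  refine ⟨hy, ?_⟩
  rw [hf, ← Finset.mul_sum] at hy'
  set e := ∫ u, f u ∂(deletionChannel δ x).toMeasure
  rw [abs_lt] at hy' ⊢
  rw [abs_le] at hmean
  have h1 : (T : ℝ) * (e - μ) ≤ T * (1 / 16) := by gcongr; exact hmean.2
  have h2 : (T : ℝ) * -(1 / 16) ≤ T * (e - μ) := by gcongr; exact hmean.1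
  constructor <;> linarith

/-! ### Reasoning about programs and their running time -/

/-- `Runs E p s c R`: started in `s`, the program `p` halts within `c` units of time in a state with
the property `R`. -/
def Runs (E : Env) (p : Prog) (s : State) (c : ℕ) (R : State → Prop) : Prop :=
  ∃ c' t, Exec E p s c' t ∧ c' ≤ c ∧ R t

theorem Runs.mono {E : Env} {p : Prog} {s : State} {c d : ℕ} {R R' : State → Prop}
    (h : Runs E p s c R) (hc : c ≤ d) (hR : ∀ t, R t → R' t) : Runs E p s d R' := by
  obtain ⟨c', t, h1, h2, h3⟩ := h
  exact ⟨c', t, h1, h2.trans hc, hR t h3⟩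

theorem Runs.seq {E : Env} {p q : Prog} {s : State} {c d : ℕ} {R R' : State → Prop}
    (hp : Runs E p s c R') (hq : ∀ t, R' t → Runs E q t d R) : Runs E (.seq p q) s (c + d) R := by
  obtain ⟨c', t, h1, h2, h3⟩ := hp
  obtain ⟨d', u, h4, h5, h6⟩ := hq t h3
  exact ⟨c' + d', u, .seq h1 h4, by omega, h6⟩

/-- Total correctness of loops: `I i` is the invariant that holds when `i` rounds remain. -/
theorem Runs.loop {E : Env} {e : Expr} {p : Prog} {c d : ℕ} (I : ℕ → State → Prop)
    (hcost : ∀ i s, I i s → e.cost E s + 1 ≤ d)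
    (htest : ∀ i s, I i s → (e.eval E s = 0 ↔ i = 0))
    (hbody : ∀ i s, I (i + 1) s → Runs E p s c (I i)) {i : ℕ} {s : State} (h : I i s) :
    Runs E (.loop e p) s (i * (c + d) + d) (I 0) := by
  induction i generalizing s with
  | zero => exact ⟨_, s, .loop_done ((htest 0 s h).2 rfl), by simpa using hcost _ s h, h⟩
  | succ i ih =>
    obtain ⟨c', t, h1, h2, h3⟩ := hbody i s h
    obtain ⟨c'', u, h4, h5, h6⟩ := ih h3
    refine ⟨_, u, .loop_step (fun h0 => absurd ((htest _ s h).1 h0) (by simp)) h1 h4, ?_, h6⟩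
    have := hcost _ s h
    rw [add_mul]
    omega

/-- The state `t` agrees with `s` on the registers below `m` and on the arrays below `l`, and no
trace has been drawn in between. -/
structure Agree (m l : ℕ) (s t : State) : Prop where
  reg : ∀ r < m, t.reg r = s.reg r
  arr : ∀ a < l, t.arr a = s.arr a
  drawn : t.drawn = s.drawn

theorem Agree.refl (m l : ℕ) (s : State) : Agree m l s s := ⟨fun _ _ => rfl, fun _ _ => rfl, rfl⟩

theorem Agree.trans {m l : ℕ} {s t u : State} (h : Agree m l s t) (h' : Agree m l t u) :
    Agree m l s u :=
  ⟨fun r hr => (h'.reg r hr).trans (h.reg r hr), fun a ha => (h'.arr a ha).trans (h.arr a ha),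
    h'.drawn.trans h.drawn⟩

theorem Agree.mono {m m' l l' : ℕ} {s t : State} (h : Agree m l s t) (hm : m' ≤ m) (hl : l' ≤ l) :
    Agree m' l' s t :=
  ⟨fun r hr => h.reg r (hr.trans_le hm), fun a ha => h.arr a (ha.trans_le hl), h.drawn⟩

theorem Agree.setReg {m l r v : ℕ} {s t : State} (h : Agree m l s t) (hr : m ≤ r) :
    Agree m l s (t.setReg r v) :=
  ⟨fun q hq => by
    rw [← h.reg q hq]; exact Function.update_of_ne (by omega) _ _, h.arr, h.drawn⟩

theorem Agree.setCell {m l a i v : ℕ} {s t : State} (h : Agree m l s t) (ha : l ≤ a) :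
    Agree m l s (t.setCell a i v) :=
  ⟨h.reg, fun q hq => by
    rw [← h.arr q hq]; exact Function.update_of_ne (by omega) _ _, h.drawn⟩

@[simp] theorem reg_setReg (s : State) (r v q : ℕ) :
    (s.setReg r v).reg q = if q = r then v else s.reg q := Function.update_apply _ _ _ _

@[simp] theorem arr_setReg (s : State) (r v : ℕ) : (s.setReg r v).arr = s.arr := rfl

@[simp] theorem reg_setCell (s : State) (a i v : ℕ) : (s.setCell a i v).reg = s.reg := rfl

@[simp] theorem arr_setCell (s : State) (a i v a' i' : ℕ) :
    (s.setCell a i v).arr a' i' = if a' = a ∧ i' = i then v else s.arr a' i' := by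
  by_cases h : a' = a
  · subst h; simp [State.setCell, Function.update_apply]
  · simp [State.setCell, h]

theorem size_mul_le (x y : ℕ) : (x * y).size ≤ x.size + y.size := by
  rw [Nat.size_le, pow_add]
  exact Nat.mul_lt_mul'' (Nat.lt_size_self x) (Nat.lt_size_self y)

theorem size_le_self (x : ℕ) : x.size ≤ x := Nat.size_le.2 Nat.lt_two_pow_self

theorem mulCost_le {x y K : ℕ} (hx : x ≤ K) (hy : y ≤ K) : (x + 1) * (y + 1) ≤ (K + 1) ^ 2 := by
  rw [sq]; gcongr

/-! ### Evaluating the estimator on one trace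

The registers `0` to `10` hold `n`, `k`, `a`, `Q`, the index of the next digit of `δ`, `G`, `M`, `T`,
`b`, `U = Q ^ k` and `V = b ^ (n + k)`. The estimates are accumulated in registers `12` and `13`,
register `14` counts the remaining traces, and register `15` holds the length of the current trace;
the registers above it are scratch space. Array `0` holds the word, array `1` the trace, and arrays
`2` and `3` the two components of the table of the dynamic program. -/

/-- Compares the letter of the trace at the position in register `16` with the letter `j` of the
word; positions beyond the end of the trace, whose length is in register `15`, match no letter. -/
def matchExpr (j : Expr) : Expr :=
  .sub (.sub (.num 1) (.add (.sub (.get 1 (.reg 16)) (.get 0 j)) (.sub (.get 0 j) (.get 1 (.reg 16)))))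
    (.sub (.num 1) (.sub (.reg 15) (.reg 16)))

/-- Replaces the table entry of the suffix that starts at the letter in register `17`. -/
def suffixStep : Prog :=
  .seq (.set 18 (matchExpr (.reg 17)))
  (.seq (.set 19 (.add (.mul (.reg 18) (.mul (.reg 8) (.get 2 (.add (.reg 17) (.num 1)))))
    (.mul (.reg 2) (.get 3 (.reg 17)))))
  (.seq (.set 20 (.add (.mul (.reg 18) (.mul (.reg 8) (.get 3 (.add (.reg 17) (.num 1)))))
    (.mul (.reg 2) (.get 2 (.reg 17)))))
  (.seq (.put 2 (.reg 17) (.reg 19))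
  (.seq (.put 3 (.reg 17) (.reg 20))
  (.set 17 (.add (.reg 17) (.num 1)))))))

/-- Moves one position to the left and updates the entry of the whole word, in cell `0`. -/
def occurrenceStep : Prog :=
  .seq (.set 16 (.sub (.reg 16) (.num 1)))
  (.seq (.set 18 (matchExpr (.num 0)))
  (.seq (.put 2 (.num 0)
    (.mul (.reg 8) (.add (.mul (.reg 18) (.get 2 (.num 1))) (.get 2 (.num 0)))))
  (.seq (.put 3 (.num 0)
    (.mul (.reg 8) (.add (.mul (.reg 18) (.get 3 (.num 1))) (.get 3 (.num 0)))))
  (.set 17 (.num 1)))))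

/-- Processes one letter of the trace: updates the entries of all suffixes of the word. -/
def letterStep : Prog :=
  .seq occurrenceStep
  (.seq (.loop (.sub (.reg 1) (.reg 17)) suffixStep)
  (.put 2 (.reg 1) (.mul (.reg 8) (.get 2 (.reg 1)))))

/-- The registers and arrays hold the length `n` of the source, the word `W`, and the numerator and
denominator of `a / b`. -/
structure Prepared (n a b : ℕ) (W : List Bool) (s : State) : Prop where
  len : s.reg 0 = n
  wordLen : s.reg 1 = W.length
  numer : s.reg 2 = a
  denom : s.reg 8 = b
  word : ∀ j (h : j < W.length), s.arr 0 j = (W[j]).toNat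

theorem Prepared.congr {n a b : ℕ} {W : List Bool} {s t : State} (h : Prepared n a b W s)
    (hr : ∀ r < 12, t.reg r = s.reg r) (ha : t.arr 0 = s.arr 0) : Prepared n a b W t where
  len := (hr 0 (by norm_num)).trans h.len
  wordLen := (hr 1 (by norm_num)).trans h.wordLen
  numer := (hr 2 (by norm_num)).trans h.numer
  denom := (hr 8 (by norm_num)).trans h.denom
  word j hj := by rw [ha]; exact h.word j hj

/-- The state is `Prepared` and the trace `y` has been read. -/
structure Loaded (n a b : ℕ) (W y : List Bool) (s : State) : Prop extends Prepared n a b W s where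
  traceLen : s.reg 15 = y.length
  trace : ∀ t (h : t < y.length), s.arr 1 t = (y[t]).toNat

theorem Loaded.agree {n a b : ℕ} {W y : List Bool} {s t : State} (h : Loaded n a b W y s)
    (h' : Agree 16 2 s t) : Loaded n a b W y t where
  toPrepared := h.congr (fun r hr => h'.reg r (by omega)) (h'.arr 0 (by norm_num))
  traceLen := (h'.reg 15 (by norm_num)).trans h.traceLen
  trace j hj := by rw [h'.arr 1 (by norm_num)]; exact h.trace j hj

theorem Loaded.eval_matchExpr {n a b : ℕ} {W y : List Bool} {s : State}
    (h : Loaded n a b W y s) (E : Env) {e : Expr} {j : ℕ} (he : e.eval E s = j)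
    (hj : j < W.length) :
    (matchExpr e).eval E s = if y[s.reg 16]? = some W[j] then 1 else 0 := by
  simp only [matchExpr, Expr.eval, he, h.word j hj, h.traceLen]
  rcases lt_or_ge (s.reg 16) y.length with h1 | h1
  · rw [h.trace _ h1, List.getElem?_eq_getElem h1]
    have h2 : 1 - (y.length - s.reg 16) = 0 := by omega
    rw [h2]
    cases y[s.reg 16] <;> cases W[j] <;> simp
  · have h2 : y.length - s.reg 16 = 0 := by omega
    simp [h1, h2]

/-- The pair `(p, q)` of natural numbers represents the real number `v` in the form
`(p - q) / b ^ e`, where `p + q ≤ m * Q ^ e`. Powers of `b` clear all denominators, and the bound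
controls the bit lengths. -/
structure Represents (b Q m e : ℕ) (v : ℝ) (p q : ℕ) : Prop where
  eq : (p : ℝ) - q = b ^ e * v
  le : p + q ≤ m * Q ^ e

/-- Multiplication by `z = -a / b` exchanges the two components. -/
theorem Represents.combine {a b e p₁ q₁ p q c : ℕ} {v₁ v : ℝ} (hb : b ≠ 0) (hc : c ≤ 1)
    (h₁ : Represents b (a + b) 1 e v₁ p₁ q₁) (h : Represents b (a + b) 1 e v p q) :
    Represents b (a + b) 1 (e + 1) (c * v₁ + -(a / b : ℝ) * v)
      (c * (b * p₁) + a * q) (c * (b * q₁) + a * p) where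
  eq := by
    have hb' : (b : ℝ) ≠ 0 := by exact_mod_cast hb
    have h2 := h₁.eq
    have h3 := h.eq
    push_cast
    have : (b : ℝ) ^ (e + 1) * (c * v₁ + -(a / b : ℝ) * v) =
        c * b * (b ^ e * v₁) - a * (b ^ e * v) := by field_simp; ring
    rw [this, ← h2, ← h3]; ring
  le := by
    have h2 := h₁.le
    have h3 := h.le
    rw [one_mul] at *
    calc c * (b * p₁) + a * q + (c * (b * q₁) + a * p) = c * (b * (p₁ + q₁)) + a * (p + q) := by ring
      _ ≤ 1 * (b * (a + b) ^ e) + a * (a + b) ^ e := by gcongr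
      _ = (a + b) ^ (e + 1) := by ring

/-- Adds an occurrence that starts at the current letter, if it matches. -/
theorem Represents.accumulate {a b e p₁ q₁ p q c : ℕ} {v₁ v : ℝ} (hc : c ≤ 1)
    (h₁ : Represents b (a + b) 1 e v₁ p₁ q₁) (h : Represents b (a + b) e e v p q) :
    Represents b (a + b) (e + 1) (e + 1) (c * v₁ + v) (b * (c * p₁ + p)) (b * (c * q₁ + q)) where
  eq := by
    have h2 := h₁.eq
    have h3 := h.eq
    push_cast
    rw [pow_succ]
    linear_combination b * c * h2 + b * h3
  le := by
    have h2 := h₁.le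
    have h3 := h.le
    rw [one_mul] at *
    calc b * (c * p₁ + p) + b * (c * q₁ + q) = b * (c * (p₁ + q₁) + (p + q)) := by ring
      _ ≤ (a + b) * (1 * (a + b) ^ e + e * (a + b) ^ e) := by gcongr; omega
      _ = (e + 1) * (a + b) ^ (e + 1) := by ring

/-- The entry of the empty suffix, constantly `1`, only changes its denominator. -/
theorem Represents.scale {a b e p : ℕ} (h : Represents b (a + b) 1 e 1 p 0) :
    Represents b (a + b) 1 (e + 1) 1 (b * p) 0 where
  eq := by
    have := h.eq
    push_cast at *
    rw [pow_succ]
    linear_combination b * this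
  le := by
    have := h.le
    rw [one_mul] at *
    calc b * p + 0 ≤ (a + b) * (a + b) ^ e := Nat.mul_le_mul (Nat.le_add_left b a) this
      _ = (a + b) ^ (e + 1) := by ring

theorem Represents.size_le {b Q m e n L p q : ℕ} {v : ℝ} (h : Represents b Q m e v p q)
    (hL : n * Q ^ n < 2 ^ L) (hQ : 0 < Q) (hm : m ≤ n) (he : e ≤ n) :
    p.size ≤ L ∧ q.size ≤ L := by
  have h1 : m * Q ^ e ≤ n * Q ^ n := by gcongr
  have h2 := h.le
  constructor <;> rw [Nat.size_le] <;> omega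

/-- The table at stage `e`, when the trace has been read from position `t` on: cell `0` represents
the occurrence weight of the word, cell `j + 1` the gap weight of `w.drop j`. The word is `c :: w`. -/
structure Table (a b e : ℕ) (c : Bool) (w y : List Bool) (t : ℕ) (s : State) : Prop where
  occurrence : Represents b (a + b) e e (occurrenceWeight (-(a / b : ℝ)) c w (y.drop t))
    (s.arr 2 0) (s.arr 3 0)
  gap : ∀ j ≤ w.length, Represents b (a + b) 1 e (gapWeight (-(a / b : ℝ)) (w.drop j) (y.drop t))
    (s.arr 2 (j + 1)) (s.arr 3 (j + 1))
  last : s.arr 3 (w.length + 1) = 0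

/-- The table in the middle of a letter step: cell `0` and the cells of the first `i` proper
suffixes are already at stage `e + 1`, the others still at stage `e`. -/
structure PartialTable (a b e : ℕ) (c : Bool) (w y : List Bool) (t i : ℕ) (s : State) : Prop where
  occurrence : Represents b (a + b) (e + 1) (e + 1)
    (occurrenceWeight (-(a / b : ℝ)) c w (y.drop t)) (s.arr 2 0) (s.arr 3 0)
  new : ∀ j < i, Represents b (a + b) 1 (e + 1) (gapWeight (-(a / b : ℝ)) (w.drop j) (y.drop t))
    (s.arr 2 (j + 1)) (s.arr 3 (j + 1))
  old : ∀ j, i ≤ j → j ≤ w.length →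
    Represents b (a + b) 1 e (gapWeight (-(a / b : ℝ)) (w.drop j) (y.drop (t + 1)))
      (s.arr 2 (j + 1)) (s.arr 3 (j + 1))
  last : s.arr 3 (w.length + 1) = 0

section LetterStep

variable {E : Env} {n a b e L t : ℕ} {c : Bool} {w y : List Bool} {s : State}

/-- The entry of the next suffix is still at stage `e` when it is used, because the suffixes are
processed from the longest to the shortest. -/
theorem runs_suffixStep {i : ℕ} (hs : Loaded n a b (c :: w) y s) (hb : b ≠ 0) (he : e + 1 ≤ n)
    (hL : n * (a + b) ^ n < 2 ^ L) (hL' : a + b ≤ L) (ht : s.reg 16 = t) (hj : s.reg 17 = i + 1)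
    (hi : i < w.length) (hT : PartialTable a b e c w y t i s) :
    Runs E suffixStep s (100 * (L + 1) ^ 2) fun u =>
      Agree 17 2 s u ∧ u.reg 17 = i + 2 ∧ PartialTable a b e c w y t (i + 1) u := by
  have hm := hs.eval_matchExpr E (e := .reg 17) (j := i + 1) (by simpa [Expr.eval] using hj)
    (by simpa using hi)
  rw [ht, List.getElem_cons_succ] at hm
  set m := (matchExpr (.reg 17)).eval E s with hmd
  have hm1 : m ≤ 1 := by rw [hm]; split_ifs <;> omega
  have hmc : (matchExpr (.reg 17)).cost E s = 19 := rfl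
  have hold := hT.old i le_rfl hi.le
  have hnext := hT.old (i + 1) (by omega) hi
  have hcomb := hnext.combine hb hm1 hold
  have hval : (m : ℝ) * gapWeight (-(a / b : ℝ)) (w.drop (i + 1)) (y.drop (t + 1)) +
      -(a / b : ℝ) * gapWeight (-(a / b : ℝ)) (w.drop i) (y.drop (t + 1)) =
      gapWeight (-(a / b : ℝ)) (w.drop i) (y.drop t) := by
    rw [List.drop_eq_getElem_cons hi, gapWeight_cons_drop (y := y) (t := t), hm]
    split_ifs <;> simp
  rw [hval] at hcomb
  refine ⟨_, _, .seq (.set _ _ _) (.seq (.set _ _ _) (.seq (.set _ _ _) (.seq (.put _ _ _ _)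
    (.seq (.put _ _ _ _) (.set _ _ _))))), ?_, ?_, ?_, ?_⟩
  · obtain ⟨h1, h2⟩ := hold.size_le hL (by omega) (by omega) (by omega)
    obtain ⟨h3, h4⟩ := hnext.size_le hL (by omega) (by omega) (by omega)
    have h5 : a.size ≤ L := (size_le_self a).trans (by omega)
    have h6 : b.size ≤ L := (size_le_self b).trans (by omega)
    have h7 : m.size ≤ 1 := (size_le_self m).trans hm1
    have h8 : ∀ x : ℕ, x.size ≤ L →
        (m.size + 1) * ((b * x).size + 1) ≤ 4 * (L + 1) ^ 2 := by
      intro x hx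
      have := size_mul_le b x
      calc (m.size + 1) * ((b * x).size + 1) ≤ 2 * (2 * L + 1) := by gcongr <;> omega
        _ ≤ 4 * (L + 1) ^ 2 := by nlinarith
    have h9 := h8 _ h3
    have h10 := h8 _ h4
    have h11 := mulCost_le h6 h3
    have h12 := mulCost_le h6 h4
    have h13 := mulCost_le h5 h1
    have h14 := mulCost_le h5 h2
    have h15 : 1 ≤ (L + 1) ^ 2 := Nat.one_le_pow _ _ (by omega)
    simp only [hmc, ← hmd, Expr.cost, Expr.eval, reg_setReg, arr_setReg, hs.numer,
      hs.denom, hj, Nat.reduceEqDiff, if_true, if_false]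
    omega
  · exact (((((Agree.refl 17 2 s).setReg (by norm_num)).setReg (by norm_num)).setReg
      (by norm_num)).setCell le_rfl).setCell (by norm_num) |>.setReg le_rfl
  · simp [Expr.eval, hj]
  · simp only [← hmd]
    have hne : w.length ≠ i := by omega
    constructor
    · simpa [Expr.eval, hj] using hT.occurrence
    · intro j hj'
      rcases (Nat.lt_succ_iff.1 hj').lt_or_eq with h | rfl
      · simpa [Expr.eval, hj, h.ne] using hT.new j h
      · simpa [Expr.eval, hj, hs.numer, hs.denom] using hcomb
    · intro j h1 h2
      have h3 : j ≠ i := by omega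
      simpa [Expr.eval, hj, h3] using hT.old j (by omega) h2
    · simpa [Expr.eval, hj, hne] using hT.last

theorem runs_occurrenceStep (hs : Loaded n a b (c :: w) y s) (hb : b ≠ 0) (he : e + 1 ≤ n)
    (hL : n * (a + b) ^ n < 2 ^ L) (hL' : a + b ≤ L) (ht : s.reg 16 = t + 1)
    (hT : Table a b e c w y (t + 1) s) :
    Runs E occurrenceStep s (100 * (L + 1) ^ 2) fun u =>
      Agree 16 2 s u ∧ u.reg 16 = t ∧ u.reg 17 = 1 ∧ PartialTable a b e c w y t 0 u := by
  have hs' : Loaded n a b (c :: w) y (s.setReg 16 t) :=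
    hs.agree ((Agree.refl 16 2 s).setReg le_rfl)
  have hm := hs'.eval_matchExpr E (e := .num 0) (j := 0) rfl (by simp)
  set m := (matchExpr (.num 0)).eval E (s.setReg 16 t) with hmd
  rw [reg_setReg, if_pos rfl, List.getElem_cons_zero] at hm
  have hm1 : m ≤ 1 := by rw [hm]; split_ifs <;> omega
  have hmc : (matchExpr (.num 0)).cost E (s.setReg 16 t) = 19 := rfl
  have hgap := hT.gap 0 (Nat.zero_le _)
  have hocc := hgap.accumulate hm1 hT.occurrence
  have hval : (m : ℝ) * gapWeight (-(a / b : ℝ)) (w.drop 0) (y.drop (t + 1)) +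
      occurrenceWeight (-(a / b : ℝ)) c w (y.drop (t + 1)) =
      occurrenceWeight (-(a / b : ℝ)) c w (y.drop t) := by
    rw [occurrenceWeight_drop (t := t), hm, List.drop_zero]
    split_ifs <;> simp
  rw [hval] at hocc
  refine ⟨_, _, .seq (.set _ _ _) (.seq (.set _ _ _) (.seq (.put _ _ _ _)
    (.seq (.put _ _ _ _) (.set _ _ _)))), ?_, ?_, ?_, ?_, ?_⟩
  · have h1 : s.reg 16 - 1 = t := by omega
    obtain ⟨h2, h3⟩ := hgap.size_le hL (by omega) (by omega) (by omega)
    have h6 : b.size ≤ L := (size_le_self b).trans (by omega)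
    have h7 : m.size ≤ L := (size_le_self m).trans (by omega)
    have hle : (e + 1) * (a + b) ^ e ≤ n * (a + b) ^ n := by gcongr <;> omega
    have h8 : ∀ x y : ℕ, x ≤ (a + b) ^ e → y ≤ e * (a + b) ^ e → (m * x + y).size ≤ L := by
      intro x y hx hy
      rw [Nat.size_le]
      refine lt_of_le_of_lt ?_ hL
      calc m * x + y ≤ 1 * (a + b) ^ e + e * (a + b) ^ e := by gcongr
        _ = (e + 1) * (a + b) ^ e := by ring
        _ ≤ _ := hle
    have h9 := hgap.le
    have h10 := hT.occurrence.le
    rw [one_mul] at h9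
    have h11 := mulCost_le h6 (h8 (s.arr 2 1) (s.arr 2 0) (by simp at h9; omega) (by omega))
    have h12 := mulCost_le h6 (h8 (s.arr 3 1) (s.arr 3 0) (by simp at h9; omega) (by omega))
    have h13 := mulCost_le h7 h2
    have h14 := mulCost_le h7 h3
    have h15 : 1 ≤ (L + 1) ^ 2 := Nat.one_le_pow _ _ (by omega)
    simp only [Expr.eval, h1, hmc, ← hmd, Expr.cost, reg_setReg, arr_setReg, reg_setCell,
      hs.denom, Nat.reduceEqDiff, if_true, if_false, arr_setCell,
      false_and, zero_add] at h13 h14 ⊢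
    omega
  · exact (((((Agree.refl 16 2 s).setReg le_rfl).setReg (by norm_num)).setCell
      le_rfl).setCell (by norm_num)).setReg (by norm_num)
  · simp [Expr.eval, ht]
  · simp [Expr.eval]
  · have h1 : s.reg 16 - 1 = t := by omega
    simp only [Expr.eval, h1]
    simp only [← hmd]
    constructor
    · simpa [Expr.eval, hs.denom] using hocc
    · intro j hj'
      omega
    · intro j _ h2
      simpa [Expr.eval] using hT.gap j h2
    · simpa [Expr.eval] using hT.last

theorem runs_letterStep (hs : Loaded n a b (c :: w) y s) (hb : b ≠ 0) (he : e + 1 ≤ n)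
    (hw : w.length + 1 ≤ n)
    (hL : n * (a + b) ^ n < 2 ^ L) (hL' : a + b ≤ L) (ht : s.reg 16 = t + 1)
    (hT : Table a b e c w y (t + 1) s) :
    Runs E letterStep s (300 * n * (L + 1) ^ 2) fun u =>
      Agree 16 2 s u ∧ u.reg 16 = t ∧ Table a b (e + 1) c w y t u := by
  have hK : 1 ≤ (L + 1) ^ 2 := Nat.one_le_pow _ _ (by omega)
  have h := (runs_occurrenceStep (E := E) hs hb he hL hL' ht hT).seq
    (q := .seq (.loop (.sub (.reg 1) (.reg 17)) suffixStep)
      (.put 2 (.reg 1) (.mul (.reg 8) (.get 2 (.reg 1)))))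
    (d := (w.length * (100 * (L + 1) ^ 2 + 4) + 4) + 10 * (L + 1) ^ 2)
    (R := fun u => Agree 16 2 s u ∧ u.reg 16 = t ∧ Table a b (e + 1) c w y t u) ?_
  · refine h.mono ?_ fun _ h => h
    have : w.length * (100 * (L + 1) ^ 2 + 4) ≤ w.length * (104 * (L + 1) ^ 2) := by
      gcongr; omega
    calc _ ≤ (w.length + 1) * (300 * (L + 1) ^ 2) := by rw [add_one_mul]; nlinarith
      _ ≤ n * (300 * (L + 1) ^ 2) := by gcongr
      _ = _ := by ring
  rintro s₁ ⟨hA₁, ht₁, hj₁, hT₁⟩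
  have hs₁ := hs.agree hA₁
  refine Runs.seq (R' := fun u => Agree 17 2 s₁ u ∧ PartialTable a b e c w y t w.length u) ?_ ?_
  · refine (Runs.loop (fun i u => Agree 17 2 s₁ u ∧ i ≤ w.length ∧ u.reg 17 = w.length - i + 1 ∧
      PartialTable a b e c w y t (w.length - i) u) ?_ ?_ ?_ (i := w.length) (s := s₁)
      ⟨Agree.refl _ _ _, le_rfl, by simpa using hj₁, by simpa using hT₁⟩).mono le_rfl ?_
    · intro i u _
      simp [Expr.cost]
    · rintro i u ⟨hA, hi, hj, -⟩
      simp only [Expr.eval, hA.reg 1 (by norm_num), hj, hs₁.wordLen, List.length_cons]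
      omega
    · rintro i u ⟨hA, hi, hj, hT⟩
      have h := runs_suffixStep (E := E) (i := w.length - (i + 1))
        (hs₁.agree (hA.mono (by norm_num) le_rfl)) hb he hL hL'
        ((hA.reg 16 (by norm_num)).trans ht₁) hj (by omega) hT
      refine h.mono le_rfl ?_
      rintro v ⟨hA', hj', hT'⟩
      have h1 : w.length - (i + 1) + 1 = w.length - i := by omega
      exact ⟨hA.trans hA', by omega, by rw [hj']; omega, h1 ▸ hT'⟩
    · rintro u ⟨hA, -, -, hT⟩
      exact ⟨hA, by simpa using hT⟩
  · rintro u ⟨hA, hT⟩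
    have hs₂ := hs₁.agree (hA.mono (by norm_num) le_rfl)
    have hlast := hT.old w.length le_rfl le_rfl
    rw [hT.last, List.drop_length, gapWeight_nil] at hlast
    refine ⟨_, _, .put _ _ _ _, ?_, ?_, ?_, ?_⟩
    · have h1 := (hlast.size_le hL (by omega) (by omega) (by omega)).1
      have h2 : b.size ≤ L := (size_le_self b).trans (by omega)
      have h3 := mulCost_le h2 h1
      simp only [Expr.cost, Expr.eval, hs₂.wordLen, hs₂.denom, List.length_cons]
      omega
    · exact (hA₁.trans (hA.mono (by norm_num) le_rfl)).setCell le_rfl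
    · exact (hA.reg 16 (by norm_num)).trans ht₁
    · constructor
      · simpa [Expr.eval, hs₂.wordLen] using hT.occurrence
      · intro j hj
        rcases hj.lt_or_eq with h | rfl
        · simpa [Expr.eval, hs₂.wordLen, h.ne] using hT.new j h
        · simpa [Expr.eval, hs₂.wordLen, hs₂.denom, hT.last] using hlast.scale
      · simpa [Expr.eval] using hT.last

end LetterStep

/-- Writes the table that belongs to the empty suffix of the trace. -/
def clearTable : Prog :=
  .seq (.set 17 (.num 0))
  (.seq (.loop (.sub (.reg 1) (.reg 17))
    (.seq (.put 2 (.reg 17) (.num 0))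
    (.seq (.put 3 (.reg 17) (.num 0))
    (.set 17 (.add (.reg 17) (.num 1))))))
  (.seq (.put 2 (.reg 1) (.num 1))
  (.seq (.put 3 (.reg 1) (.num 0))
  (.set 16 (.reg 0)))))

/-- Adds the value of cell `0` of the table to the accumulators in registers `12` and `13`, and
decrements the number of traces still to be drawn, in register `14`. -/
def accumulateStep : Prog :=
  .seq (.set 12 (.add (.reg 12) (.get 2 (.num 0))))
  (.seq (.set 13 (.add (.reg 13) (.get 3 (.num 0))))
  (.set 14 (.sub (.reg 14) (.num 1))))

/-- Draws one trace, evaluates the estimator on it and adds the result to the accumulators. -/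
def traceStep : Prog :=
  .seq (.draw 1 15)
  (.seq clearTable
  (.seq (.loop (.reg 16) letterStep)
  accumulateStep))

section TraceStep

variable {E : Env} {n a b e L t : ℕ} {c : Bool} {w y : List Bool} {s : State}

/-- Reading starts at position `n`, at or beyond the end of the trace, so that every trace takes
exactly `n` letter steps and yields a value with denominator `b ^ n`. -/
theorem runs_clearTable (hs : Loaded n a b (c :: w) y s) (hw : w.length + 1 ≤ n)
    (hy : y.length ≤ n) :
    Runs E clearTable s (50 * n) fun u =>
      Agree 16 2 s u ∧ u.reg 16 = n ∧ Table a b 0 c w y n u := by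
  refine Runs.mono (c := 2 + ((w.length + 1) * (20 + 4) + 4 + 10)) (Runs.seq
    (R' := fun u => Agree 16 2 s u ∧ u.reg 17 = 0)
    ⟨_, _, .set _ _ _, le_rfl, (Agree.refl _ _ _).setReg (by norm_num), by simp [Expr.eval]⟩
    (R := fun u => Agree 16 2 s u ∧ u.reg 16 = n ∧ Table a b 0 c w y n u) ?_)
    (by omega) fun _ h => h
  rintro s₁ ⟨hA₁, hj₁⟩
  have hs₁ := hs.agree hA₁
  refine Runs.seq (R' := fun u => Agree 17 2 s₁ u ∧
    ∀ j < w.length + 1, u.arr 2 j = 0 ∧ u.arr 3 j = 0) ?_ ?_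
  · refine (Runs.loop (fun i u => Agree 17 2 s₁ u ∧ i ≤ w.length + 1 ∧
      u.reg 17 = w.length + 1 - i ∧
      ∀ j < w.length + 1 - i, u.arr 2 j = 0 ∧ u.arr 3 j = 0) ?_ ?_ ?_ (i := w.length + 1) (s := s₁)
      ⟨Agree.refl _ _ _, le_rfl, by simpa using hj₁, by simp⟩).mono le_rfl ?_
    · intro i u _
      simp [Expr.cost]
    · rintro i u ⟨hA, hi, hj, -⟩
      simp only [Expr.eval, hA.reg 1 (by norm_num), hj, hs₁.wordLen, List.length_cons]
      omega
    · rintro i u ⟨hA, hi, hj, hT⟩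
      refine ⟨_, _, .seq (.put _ _ _ _) (.seq (.put _ _ _ _) (.set _ _ _)), ?_, ?_, ?_, ?_, ?_⟩
      · simp [Expr.cost]
      · exact ((hA.setCell le_rfl).setCell (by norm_num)).setReg le_rfl
      · omega
      · simp [Expr.eval, hj]; omega
      · intro j hj'
        by_cases h : j = w.length - i
        · simp [Expr.eval, hj, h]
        · have := hT j (by omega)
          simpa [Expr.eval, hj, h] using this
    · rintro u ⟨hA, -, -, hT⟩
      exact ⟨hA, by simpa using hT⟩
  · rintro u ⟨hA, hT⟩
    have hA' := hA.mono (m' := 16) (l' := 2) (by norm_num) le_rfl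
    have hs₂ := hs₁.agree hA'
    refine ⟨_, _, .seq (.put _ _ _ _) (.seq (.put _ _ _ _) (.set _ _ _)), ?_, ?_, ?_, ?_⟩
    · simp [Expr.cost]
    · exact (((hA₁.trans hA').setCell le_rfl).setCell (by norm_num)).setReg le_rfl
    · simp [Expr.eval, hs₂.len]
    · have hd : y.drop n = [] := List.drop_eq_nil_of_le hy
      constructor
      · obtain ⟨h1, h2⟩ := hT 0 (by omega)
        rw [hd]
        constructor <;> simp [Expr.eval, hs₂.wordLen, h1, h2, occurrenceWeight]
      · intro j hj
        rw [hd]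
        rcases hj.lt_or_eq with h | rfl
        · obtain ⟨h1, h2⟩ := hT (j + 1) (by omega)
          rw [List.drop_eq_getElem_cons h]
          constructor <;> simp [Expr.eval, hs₂.wordLen, h1, h2, gapWeight, h.ne]
        · constructor <;> simp [Expr.eval, hs₂.wordLen]
      · simp [Expr.eval, hs₂.wordLen]

theorem runs_traceStep (hs : Prepared n a b (c :: w) s) (hb : b ≠ 0) (hw : w.length + 1 ≤ n)
    (hL : n * (a + b) ^ n < 2 ^ L) (hL' : a + b ≤ L) (hy : (E.trace s.drawn).length ≤ n) :
    Runs E traceStep s (400 * n ^ 2 * (L + 1) ^ 2) fun u =>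
      ((∀ r < 12, u.reg r = s.reg r) ∧ u.arr 0 = s.arr 0) ∧ u.drawn = s.drawn + 1 ∧
      u.reg 14 = s.reg 14 - 1 ∧
      ∃ p q, Represents b (a + b) n n (occurrenceWeight (-(a / b : ℝ)) c w (E.trace s.drawn)) p q ∧
        u.reg 12 = s.reg 12 + p ∧ u.reg 13 = s.reg 13 + q := by
  have hK : 1 ≤ (L + 1) ^ 2 := Nat.one_le_pow _ _ (by omega)
  set y := E.trace s.drawn with hyd
  refine Runs.mono (c := (y.length + 1) + (50 * n + ((n * (300 * n * (L + 1) ^ 2 + 2) + 2) + 20)))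
    (Runs.seq (R' := fun u => u = s.receive 1 15 y) ⟨_, _, .draw _ _ _, le_rfl, rfl⟩ ?_) ?_
    fun _ h => h
  · rintro _ rfl
    set s₀ := s.receive 1 15 y with hs₀
    have hrecv : (∀ r < 15, s₀.reg r = s.reg r) ∧ s₀.arr 0 = s.arr 0 := by
      refine ⟨fun r hr => ?_, by simp [hs₀, State.receive]⟩
      have : r ≠ 15 := by omega
      simp [hs₀, State.receive, this]
    have hl₀ : Loaded n a b (c :: w) y s₀ :=
      { toPrepared := hs.congr (fun r hr => hrecv.1 r (by omega)) hrecv.2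
        traceLen := by simp [hs₀, State.receive]
        trace := fun t ht => by simp [hs₀, State.receive, writeBits, ht] }
    refine (runs_clearTable hl₀ hw hy).seq ?_
    rintro s₁ ⟨hA₁, ht₁, hT₁⟩
    refine Runs.seq (R' := fun u => Agree 16 2 s₀ u ∧ Table a b n c w y 0 u) ?_ ?_
    · refine (Runs.loop (fun i u => i ≤ n ∧ Agree 16 2 s₀ u ∧ u.reg 16 = i ∧
        Table a b (n - i) c w y i u) ?_ ?_ ?_ (i := n) (s := s₁)
        ⟨le_rfl, hA₁, ht₁, by simpa using hT₁⟩).mono le_rfl ?_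
      · intro i u _
        simp [Expr.cost]
      · rintro i u ⟨-, -, hi, -⟩
        simp [Expr.eval, hi]
      · rintro i u ⟨hin, hA, hi, hT⟩
        have h1 : n - (i + 1) + 1 = n - i := by omega
        refine (runs_letterStep (hl₀.agree hA) hb (by omega) hw hL hL' hi hT).mono le_rfl ?_
        rintro v ⟨hA', ht', hT'⟩
        exact ⟨by omega, hA.trans hA', ht', h1 ▸ hT'⟩
      · rintro u ⟨-, hA, -, hT⟩
        exact ⟨hA, by simpa using hT⟩
    · rintro u ⟨hA, hT⟩
      have hreg : ∀ r < 15, u.reg r = s.reg r := fun r hr =>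
        (hA.reg r (by omega)).trans (hrecv.1 r hr)
      refine ⟨_, _, .seq (.set _ _ _) (.seq (.set _ _ _) (.set _ _ _)), ?_, ⟨?_, ?_⟩, ?_, ?_,
        u.arr 2 0, u.arr 3 0, ?_, ?_, ?_⟩
      · simp [Expr.cost]
      · intro r hr
        have h1 : r ≠ 12 := by omega
        have h2 : r ≠ 13 := by omega
        have h3 : r ≠ 14 := by omega
        simp [h1, h2, h3, hreg r (by omega)]
      · exact (hA.arr 0 (by norm_num)).trans hrecv.2
      · exact hA.drawn
      · simp [Expr.eval, hreg 14]
      · simpa using hT.occurrence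
      · simp [Expr.eval, hreg 12]
      · simp [Expr.eval, hreg 13]
  · have hn : 1 ≤ n := by omega
    have h1 : n ≤ n ^ 2 := by nlinarith
    have h2 : n ^ 2 ≤ n ^ 2 * (L + 1) ^ 2 := Nat.le_mul_of_pos_right _ (by omega)
    have h3 : 2 ^ 2 ≤ (L + 1) ^ 2 := Nat.pow_le_pow_left (by omega) 2
    have h4 : 76 * n ^ 2 ≤ 19 * (n ^ 2 * (L + 1) ^ 2) := by nlinarith
    have h5 : n * (300 * n * (L + 1) ^ 2 + 2) = 300 * (n ^ 2 * (L + 1) ^ 2) + 2 * n := by ring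
    rw [h5, mul_assoc 400]
    omega

/-- The loop over all traces. -/
theorem runs_traceLoop {T : ℕ} (hs : Prepared n a b (c :: w) s) (hb : b ≠ 0)
    (hw : w.length + 1 ≤ n) (hL : n * (a + b) ^ n < 2 ^ L) (hL' : a + b ≤ L)
    (hy : ∀ i, (E.trace i).length ≤ n) (hdrawn : s.drawn = 0) (h12 : s.reg 12 = 0)
    (h13 : s.reg 13 = 0) (h14 : s.reg 14 = T) :
    Runs E (.loop (.reg 14) traceStep) s (T * (400 * n ^ 2 * (L + 1) ^ 2 + 2) + 2) fun u =>
      ((∀ r < 12, u.reg r = s.reg r) ∧ u.arr 0 = s.arr 0) ∧ u.drawn = T ∧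
      (u.reg 12 : ℝ) - u.reg 13 =
        b ^ n * ∑ i ∈ Finset.range T, occurrenceWeight (-(a / b : ℝ)) c w (E.trace i) ∧
      u.reg 12 + u.reg 13 ≤ T * (n * (a + b) ^ n) := by
  refine (Runs.loop (fun i u => i ≤ T ∧ ((∀ r < 12, u.reg r = s.reg r) ∧ u.arr 0 = s.arr 0) ∧
    u.drawn = T - i ∧ u.reg 14 = i ∧ (u.reg 12 : ℝ) - u.reg 13 =
      b ^ n * ∑ j ∈ Finset.range (T - i), occurrenceWeight (-(a / b : ℝ)) c w (E.trace j) ∧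
    u.reg 12 + u.reg 13 ≤ (T - i) * (n * (a + b) ^ n)) ?_ ?_ ?_ (i := T) (s := s)
    ⟨le_rfl, ⟨fun _ _ => rfl, rfl⟩, by simpa using hdrawn, h14, by simp [h12, h13],
      by simp [h12, h13]⟩).mono le_rfl ?_
  · intro i u _
    simp [Expr.cost]
  · rintro i u ⟨-, -, -, hi, -⟩
    simp [Expr.eval, hi]
  · rintro i u ⟨hiT, ⟨hreg, harr⟩, hd, hi, hsum, hle⟩
    refine (runs_traceStep (hs.congr hreg harr) hb hw hL hL' (hy _)).mono le_rfl ?_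
    rintro v ⟨⟨hreg', harr'⟩, hd', hi', p, q, hpq, hp, hq⟩
    have h1 : T - i = T - (i + 1) + 1 := by omega
    refine ⟨by omega, ⟨fun r hr => (hreg' r hr).trans (hreg r hr), harr'.trans harr⟩, by omega,
      by omega, ?_, ?_⟩
    · rw [h1, Finset.sum_range_succ, mul_add, ← hsum, ← hd, ← hpq.eq, hp, hq]
      push_cast
      ring
    · rw [h1, add_one_mul, hp, hq]
      have := hpq.le
      omega
  · rintro u ⟨-, h, hd, -, hsum, hle⟩
    exact ⟨h, by simpa using hd, by simpa using hsum, by simpa using hle⟩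

end TraceStep

/-! ### Rounding -/

/-- One round of the division: subtracts register `17` once from register `15` minus register `16`
if the difference permits, and then counts this in register `18`. -/
def divisionStep : Prog :=
  .seq (.ite (.sub (.add (.reg 16) (.reg 17)) (.reg 15)) .skip
    (.seq (.set 16 (.add (.reg 16) (.reg 17))) (.set 18 (.add (.reg 18) (.num 1)))))
  (.set 19 (.sub (.reg 19) (.num 1)))

/-- Sets up the division of `2 p U + T V` minus `2 q U` by `2 T V`, where `p` and `q` are in the
accumulators, `U` and `V` in registers `9` and `10` and `T` in register `7`. -/
def prepareDivision : Prog :=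
  .seq (.set 15 (.add (.mul (.num 2) (.mul (.reg 12) (.reg 9))) (.mul (.reg 7) (.reg 10))))
  (.seq (.set 16 (.mul (.num 2) (.mul (.reg 13) (.reg 9))))
  (.seq (.set 17 (.mul (.num 2) (.mul (.reg 7) (.reg 10))))
  (.seq (.set 18 (.num 0))
  (.set 19 (.reg 0)))))

/-- Writes `(p - q) U / (T V)`, rounded to the nearest integer, to register `0`. If the result is at
most `n`, then `n` subtractions suffice. -/
def roundQuotient : Prog :=
  .seq prepareDivision (.seq (.loop (.reg 19) divisionStep) (.set 0 (.reg 18)))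

/-- The quotient `μ` of `X - Y` by `D` is found whenever it is at most `n`; the loop ends after `n`
rounds in any case. -/
theorem runs_divisionLoop {E : Env} {s : State} {n X Y D : ℕ} (hX : s.reg 15 = X)
    (hY : s.reg 16 = Y) (hD : s.reg 17 = D) (h18 : s.reg 18 = 0) (h19 : s.reg 19 = n) :
    Runs E (.loop (.reg 19) divisionStep) s (n * (20 + 2) + 2) fun u => u.drawn = s.drawn ∧
      ∀ μ ≤ n, Y + μ * D ≤ X → X < Y + (μ + 1) * D → u.reg 18 = μ := by
  refine (Runs.loop (fun i u => u.drawn = s.drawn ∧ i ≤ n ∧ u.reg 19 = i ∧ u.reg 15 = X ∧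
    u.reg 17 = D ∧ u.reg 16 = Y + u.reg 18 * D ∧
    ∀ μ ≤ n, Y + μ * D ≤ X → X < Y + (μ + 1) * D → u.reg 18 = min (n - i) μ) ?_ ?_ ?_
    (i := n) (s := s)
    ⟨rfl, le_rfl, h19, hX, hD, by simp [hY, h18], by simp [h18]⟩).mono le_rfl ?_
  · intro i u _
    simp [Expr.cost]
  · rintro i u ⟨-, -, hi, -⟩
    simp [Expr.eval, hi]
  · rintro i u ⟨hd, hin, hi, hX, hD, hY, h⟩
    by_cases h0 : (Expr.sub (.add (.reg 16) (.reg 17)) (.reg 15)).eval E u = 0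
    · refine ⟨_, _, .seq (.ite_false h0 (.seq (.set _ _ _) (.set _ _ _))) (.set _ _ _), ?_, ?_⟩
      · simp [Expr.cost]
      simp only [Expr.eval, hX, hY, hD] at h0
      refine ⟨hd, by omega, by simp [Expr.eval, hi], by simp [hX], by simp [hD],
        by simp [Expr.eval, hY, hD]; ring, ?_⟩
      intro μ hμ h1 h2
      have h3 := h μ hμ h1 h2
      have h4 : u.reg 18 < μ := by
        by_contra hcon
        have : (μ + 1) * D ≤ (u.reg 18 + 1) * D := by gcongr; omega
        rw [add_mul (u.reg 18)] at this
        omega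
      simp [Expr.eval]
      omega
    · refine ⟨_, _, .seq (.ite_true h0 (.skip _)) (.set _ _ _), ?_, ?_⟩
      · simp [Expr.cost]
      simp only [Expr.eval, hX, hY, hD] at h0
      refine ⟨hd, by omega, by simp [Expr.eval, hi], by simp [hX], by simp [hD],
        by simp [hY], ?_⟩
      intro μ hμ h1 h2
      have h3 := h μ hμ h1 h2
      have h4 : μ ≤ u.reg 18 := by
        by_contra hcon
        have : (u.reg 18 + 1) * D ≤ μ * D := by gcongr; omega
        rw [add_mul] at this
        omega
      simp
      omega
  · rintro u ⟨hd, -, -, -, -, -, h⟩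
    refine ⟨hd, fun μ hμ h1 h2 => ?_⟩
    rw [h μ hμ h1 h2]
    simpa using hμ

theorem runs_roundQuotient {E : Env} {s : State} {n p q T U V L : ℕ} (h0 : s.reg 0 = n)
    (h12 : s.reg 12 = p) (h13 : s.reg 13 = q) (h7 : s.reg 7 = T) (h9 : s.reg 9 = U)
    (h10 : s.reg 10 = V) (hp : p.size ≤ T + L) (hq : q.size ≤ T + L) (hU : U.size ≤ L)
    (hV : V.size ≤ 2 * L) (hT : 1 ≤ T) :
    Runs E roundQuotient s (100 * T * (L + 1) ^ 2 + (22 * n + 4)) fun u => u.drawn = s.drawn ∧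
      ∀ μ ≤ n, 2 * (q * U) + μ * (2 * (T * V)) ≤ 2 * (p * U) + T * V →
        2 * (p * U) + T * V < 2 * (q * U) + (μ + 1) * (2 * (T * V)) → u.reg 0 = μ := by
  refine (Runs.seq (c := 100 * T * (L + 1) ^ 2) (d := (n * (20 + 2) + 2) + 2)
    (R' := fun u => u.drawn = s.drawn ∧
    u.reg 15 = 2 * (p * U) + T * V ∧ u.reg 16 = 2 * (q * U) ∧ u.reg 17 = 2 * (T * V) ∧
    u.reg 18 = 0 ∧ u.reg 19 = n) ?_ ?_).mono (by omega) fun _ h => h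
  · refine ⟨_, _, .seq (.set _ _ _) (.seq (.set _ _ _) (.seq (.set _ _ _) (.seq (.set _ _ _)
      (.set _ _ _)))), ?_, rfl, ?_⟩
    · set K := T * (L + 1) ^ 2 with hK
      have hTK : T ≤ K := Nat.le_mul_of_pos_right _ (by positivity)
      have hLK : L ≤ K := by nlinarith
      have h2 : (2 : ℕ).size = 2 := by decide
      have hmul : ∀ x : ℕ, x.size ≤ T + L → (x.size + 1) * (U.size + 1) ≤ 2 * K := by
        intro x hx
        calc _ ≤ (T + L + 1) * (L + 1) := by gcongr
          _ ≤ (2 * T * (L + 1)) * (L + 1) := by gcongr; nlinarith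
          _ = 2 * K := by ring
      have hTV : (T.size + 1) * (V.size + 1) ≤ 4 * K := by
        have := size_le_self T
        calc _ ≤ (T + T) * (2 * L + 2) := by (gcongr; omega)
          _ ≤ (T + T) * (2 * L + 2) * (L + 1) := Nat.le_mul_of_pos_right _ (by omega)
          _ = 4 * K := by rw [hK]; ring
      have h3 := hmul p hp
      have h4 := hmul q hq
      have h5 := size_mul_le p U
      have h6 := size_mul_le q U
      have h7' := size_mul_le T V
      have h8 := size_le_self T
      have h9' : T + 2 * L + 1 ≤ 2 * K := by nlinarith
      simp only [Expr.cost, Expr.eval, reg_setReg, Nat.reduceEqDiff, if_false, h12, h13, h7, h9,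
        h10, h2, mul_assoc 100, ← hK]
      omega
    · simp [Expr.eval, h12, h13, h7, h9, h10, h0]
  · rintro u ⟨hd, h15, h16, h17, h18, h19⟩
    refine (runs_divisionLoop h15 h16 h17 h18 h19).seq ?_
    rintro v ⟨hd', h⟩
    refine ⟨_, _, .set _ _ _, by simp [Expr.cost], hd'.trans hd, fun μ hμ h1 h2 => ?_⟩
    simpa [Expr.eval] using h μ hμ h1 h2

/-! ### Choosing the parameters -/

/-- Appends one more digit of `δ` to the approximation `a / Q` in registers `2` and `3`. -/
def digitStep : Prog :=
  .seq (.set 2 (.add (.add (.reg 2) (.reg 2)) (.digit₁ (.reg 4))))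
  (.seq (.set 3 (.add (.reg 3) (.reg 3)))
  (.set 4 (.add (.reg 4) (.num 1))))

/-- Truncates `δ` to `a / Q`: first to the precision `1 / G` at which `2 a + 3 ≤ G`, which certifies
`1 ≤ (1 - 2 δ) G`, and then to a precision with `64 n² ≤ Q`. -/
def approximateRate : Prog :=
  .seq (.seq (.set 3 (.num 1)) (.set 4 (.num 1)))
  (.seq (.loop (.sub (.add (.add (.reg 2) (.reg 2)) (.num 3)) (.reg 3)) digitStep)
  (.seq (.set 5 (.reg 3))
  (.loop (.sub (.mul (.num 64) (.mul (.reg 0) (.reg 0))) (.reg 3)) digitStep)))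

/-- Finds the position of the first nonzero digit of `τ`. -/
def approximateConfidence : Prog :=
  .seq (.set 6 (.num 1))
  (.loop (.sub (.num 1) (.digit₂ (.reg 6))) (.set 6 (.add (.reg 6) (.num 1))))

/-- Sets `b = Q - a` and initializes the products computed by `powerStep`. -/
def startProducts : Prog :=
  .seq (.set 8 (.sub (.reg 3) (.reg 2)))
  (.seq (.set 7 (.mul (.mul (.num 128) (.mul (.reg 0) (.reg 0))) (.add (.reg 6) (.num 1))))
  (.seq (.set 9 (.num 1))
  (.seq (.set 10 (.num 1))
  (.set 11 (.reg 1)))))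

/-- Multiplies the registers `7`, `9` and `10` by `G²`, `Q` and `b`. -/
def powerStep : Prog :=
  .seq (.set 7 (.mul (.reg 7) (.mul (.reg 5) (.reg 5))))
  (.seq (.set 9 (.mul (.reg 9) (.reg 3)))
  (.seq (.set 10 (.mul (.reg 10) (.reg 8)))
  (.set 11 (.sub (.reg 11) (.num 1)))))

/-- Multiplies register `10` by `b`, for the denominator `b ^ n` of the estimates. -/
def denominatorStep : Prog :=
  .seq (.set 10 (.mul (.reg 10) (.reg 8)))
  (.set 11 (.sub (.reg 11) (.num 1)))

/-- Computes the number `T = 128 n² G²ᵏ (M + 1)` of traces and the powers `U = Qᵏ` and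
`V = bⁿ⁺ᵏ`, where `b = Q - a`. -/
def computeParameters : Prog :=
  .seq startProducts
  (.seq (.loop (.reg 11) powerStep)
  (.seq (.set 11 (.reg 0))
  (.seq (.loop (.reg 11) denominatorStep)
  (.set 14 (.reg 7)))))

section Parameters

variable {E : Env} {s : State}

/-- `A i` is the numerator of the truncation of `δ` to `i` digits; the loop takes it from precision
`i` to precision `j`. -/
theorem runs_digitLoop {A : ℕ → ℕ} (hA : ∀ i, A (i + 1) = 2 * A i + E.digit₁ (i + 1))
    {e : Expr} {d i j : ℕ} (hij : i ≤ j) (h2 : s.reg 2 = A i) (h3 : s.reg 3 = 2 ^ i)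
    (h4 : s.reg 4 = i + 1)
    (hcost : ∀ u : State, u.reg 0 = s.reg 0 → e.cost E u + 1 ≤ d)
    (htest : ∀ u : State, ∀ l, i ≤ l → l ≤ j → u.reg 0 = s.reg 0 → u.reg 2 = A l →
      u.reg 3 = 2 ^ l → (e.eval E u = 0 ↔ l = j)) :
    Runs E (.loop e digitStep) s ((j - i) * (20 + d) + d) fun u =>
      u.arr = s.arr ∧ u.drawn = s.drawn ∧
      (∀ r, r ≠ 2 → r ≠ 3 → r ≠ 4 → u.reg r = s.reg r) ∧
      u.reg 2 = A j ∧ u.reg 3 = 2 ^ j ∧ u.reg 4 = j + 1 := by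
  refine (Runs.loop (fun l u => l ≤ j - i ∧ u.arr = s.arr ∧ u.drawn = s.drawn ∧
    (∀ r, r ≠ 2 → r ≠ 3 → r ≠ 4 → u.reg r = s.reg r) ∧
    u.reg 2 = A (j - l) ∧ u.reg 3 = 2 ^ (j - l) ∧ u.reg 4 = j - l + 1) ?_ ?_ ?_ (i := j - i) (s := s)
    ?_).mono le_rfl ?_
  · rintro l u ⟨-, -, -, h, -⟩
    exact hcost u (h 0 (by norm_num) (by norm_num) (by norm_num))
  · rintro l u ⟨hl, -, -, h, h2, h3, h4⟩
    rw [htest u (j - l) (by omega) (by omega) (h 0 (by norm_num) (by norm_num) (by norm_num)) h2 h3]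
    omega
  · rintro l u ⟨hl, ha, hd, h, h2, h3, h4⟩
    have h5 : j - l = j - (l + 1) + 1 := by omega
    refine ⟨_, _, .seq (.set _ _ _) (.seq (.set _ _ _) (.set _ _ _)), ?_, ?_, ha, hd, ?_, ?_, ?_, ?_⟩
    · simp [Expr.cost]
    · omega
    · intro r h2 h3 h4
      simp [h2, h3, h4, h r]
    · simp [Expr.eval, h2, h4, h5, hA]; ring
    · simp [Expr.eval, h3, h5, pow_succ]; ring
    · simp [Expr.eval, h4, h5]
  · have h5 : j - (j - i) = i := by omega
    exact ⟨le_rfl, rfl, rfl, fun _ _ _ _ => rfl, by rw [h5, h2], by rw [h5, h3], by rw [h5, h4]⟩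
  · rintro u ⟨-, ha, hd, h, h2, h3, h4⟩
    exact ⟨ha, hd, h, h2, h3, h4⟩

theorem runs_approximateRate {A : ℕ → ℕ} (hA0 : A 0 = 0)
    (hA : ∀ i, A (i + 1) = 2 * A i + E.digit₁ (i + 1)) {n g m L : ℕ} (hgm : g ≤ m)
    (hg : ∀ i ≤ g, (2 * A i + 3 ≤ 2 ^ i ↔ i = g))
    (hm : ∀ i, g ≤ i → i ≤ m → (64 * n ^ 2 ≤ 2 ^ i ↔ i = m))
    (h0 : s.reg 0 = n) (h2 : s.reg 2 = 0) (hnL : n ≤ L) (hmL : m ≤ L) :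
    Runs E approximateRate s (100 * (L + 1) ^ 3) fun u =>
      u.arr = s.arr ∧ u.drawn = s.drawn ∧
      (∀ r, r ≠ 2 → r ≠ 3 → r ≠ 4 → r ≠ 5 → u.reg r = s.reg r) ∧
      u.reg 2 = A m ∧ u.reg 3 = 2 ^ m ∧ u.reg 5 = 2 ^ g := by
  have hK : 1 ≤ (L + 1) ^ 2 := Nat.one_le_pow _ _ (by omega)
  refine (Runs.seq (c := 4) (R' := fun u => u.arr = s.arr ∧ u.drawn = s.drawn ∧
    (∀ r, r ≠ 3 → r ≠ 4 → u.reg r = s.reg r) ∧ u.reg 3 = 1 ∧ u.reg 4 = 1)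
    ⟨_, _, .seq (.set _ _ _) (.set _ _ _), by simp [Expr.cost], rfl, rfl, ?_, by simp [Expr.eval],
      by simp [Expr.eval]⟩ (d := ((g - 0) * (20 + 8) + 8) + (2 + ((m - g) * (20 + 40 * (L + 1) ^ 2) +
        40 * (L + 1) ^ 2))) ?_).mono ?_ fun _ h => h
  · intro r h3 h4
    simp [h3, h4]
  · rintro s₁ ⟨ha₁, hd₁, hr₁, h3, h4⟩
    refine (runs_digitLoop hA (i := 0) (j := g) (Nat.zero_le _)
      (by rw [hr₁ 2 (by norm_num) (by norm_num), h2, hA0]) h3 h4 ?_ ?_).seq ?_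
    · intro u _
      simp [Expr.cost]
    · intro u l _ hl _ hu2 hu3
      rw [← hg l hl]
      simp only [Expr.eval, hu2, hu3]
      omega
    rintro s₂ ⟨ha₂, hd₂, hr₂, h2', h3', h4'⟩
    refine Runs.seq (R' := fun u => u = s₂.setReg 5 (2 ^ g))
      ⟨_, _, .set _ _ _, by simp [Expr.cost], by simp [Expr.eval, h3']⟩ ?_
    rintro _ rfl
    have h0' : (s₂.setReg 5 (2 ^ g)).reg 0 = n := by
      simp [hr₂ 0, hr₁ 0, h0]
    refine (runs_digitLoop hA (i := g) (j := m) hgm (by simpa using h2') (by simpa using h3')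
      (by simpa using h4') ?_ ?_).mono le_rfl ?_
    · intro u hu
      rw [h0'] at hu
      have h5 : n.size ≤ L := (size_le_self n).trans hnL
      have h6 := mulCost_le h5 h5
      have h7 := size_mul_le n n
      have h8 : (64 : ℕ).size = 7 := by decide
      have h9 : 2 * L + 1 ≤ 2 * (L + 1) ^ 2 := by nlinarith
      simp only [Expr.cost, Expr.eval, hu, h8]
      omega
    · intro u l hl hl' hu hu2 hu3
      rw [h0'] at hu
      rw [← hm l hl hl']
      simp only [Expr.eval, hu, hu3, sq]
      omega
    · rintro u ⟨ha, hd, hr, hu2, hu3, -⟩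
      refine ⟨ha.trans (ha₂.trans ha₁), hd.trans (hd₂.trans hd₁), ?_, hu2, hu3, ?_⟩
      · intro r e2 e3 e4 e5
        rw [hr r e2 e3 e4, reg_setReg, if_neg e5, hr₂ r e2 e3 e4, hr₁ r e3 e4]
      · rw [hr 5 (by norm_num) (by norm_num) (by norm_num)]; simp
  · have h1 : (m - g) * (20 + 40 * (L + 1) ^ 2) ≤ L * (60 * (L + 1) ^ 2) := by
      gcongr <;> omega
    have h2 : (L + 1) ^ 3 = L * (L + 1) ^ 2 + (L + 1) ^ 2 := by ring
    have h3 : L ≤ L * (L + 1) ^ 2 := Nat.le_mul_of_pos_right _ (by omega)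
    have h4 : L * (60 * (L + 1) ^ 2) = 60 * (L * (L + 1) ^ 2) := by ring
    omega

theorem runs_approximateConfidence {M : ℕ} (hM1 : 1 ≤ M) (hM : E.digit₂ M = 1)
    (hM' : ∀ i, 1 ≤ i → i < M → E.digit₂ i = 0) :
    Runs E approximateConfidence s (20 * M + 10) fun u =>
      u.arr = s.arr ∧ u.drawn = s.drawn ∧ (∀ r, r ≠ 6 → u.reg r = s.reg r) ∧ u.reg 6 = M := by
  refine (Runs.seq (R' := fun u => u = s.setReg 6 1) ⟨_, _, .set _ _ _, le_rfl, rfl⟩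
    (d := (M - 1) * (4 + 5) + 5) ?_).mono (by simp [Expr.cost]; omega) fun _ h => h
  rintro _ rfl
  refine (Runs.loop (fun i u => i ≤ M - 1 ∧ u.arr = s.arr ∧ u.drawn = s.drawn ∧
    (∀ r, r ≠ 6 → u.reg r = s.reg r) ∧ u.reg 6 = M - i) ?_ ?_ ?_ (i := M - 1)
    (s := s.setReg 6 1) ⟨le_rfl, rfl, rfl, ?_, ?_⟩).mono le_rfl ?_
  · rintro i u -
    simp [Expr.cost]
  · rintro i u ⟨hi, -, -, -, h⟩
    simp only [Expr.eval, h]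
    rcases Nat.eq_zero_or_pos i with rfl | h0
    · simp [hM]
    · rw [hM' (M - i) (by omega) (by omega)]; omega
  · rintro i u ⟨hi, ha, hd, hr, h⟩
    refine ⟨_, _, .set _ _ _, by simp [Expr.cost], by omega, ha, hd, ?_, ?_⟩
    · intro r hr6
      simp [hr6, hr r]
    · simp [Expr.eval, h]; omega
  · intro r hr6
    simp [hr6]
  · simp; omega
  · rintro u ⟨-, ha, hd, hr, h⟩
    exact ⟨ha, hd, hr, by simpa using h⟩

theorem runs_startProducts {n k a b M : ℕ} (h0 : s.reg 0 = n) (h1 : s.reg 1 = k)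
    (h2 : s.reg 2 = a) (h3 : s.reg 3 = a + b) (h6 : s.reg 6 = M) :
    Runs E startProducts s
      ((n.size + 1) * (n.size + 1) + 9 * ((n * n).size + 1) +
        ((128 * (n * n)).size + 1) * ((M + 1).size + 1) + 30) fun u =>
      u.arr = s.arr ∧ u.drawn = s.drawn ∧
      (∀ r, r < 7 ∨ r = 12 ∨ r = 13 → u.reg r = s.reg r) ∧
      u.reg 7 = 128 * n ^ 2 * (M + 1) ∧ u.reg 8 = b ∧ u.reg 9 = 1 ∧ u.reg 10 = 1 ∧
      u.reg 11 = k := by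
  refine ⟨_, _, .seq (.set _ _ _) (.seq (.set _ _ _) (.seq (.set _ _ _) (.seq (.set _ _ _)
      (.set _ _ _)))), ?_, rfl, rfl, ?_, ?_, ?_, ?_, ?_, ?_⟩
  · have e3 : (128 : ℕ).size = 8 := by decide
    simp only [Expr.cost, Expr.eval, reg_setReg, Nat.reduceEqDiff, if_false, h0, h6, e3]
    omega
  · rintro r hr
    have e1 : r ≠ 7 := by omega
    have e2 : r ≠ 8 := by omega
    have e3 : r ≠ 9 := by omega
    have e4 : r ≠ 10 := by omega
    have e5 : r ≠ 11 := by omega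
    simp [e1, e2, e3, e4, e5]
  · simp [Expr.eval, h0, h6]; ring
  · simp [Expr.eval, h2, h3]
  · simp [Expr.eval]
  · simp [Expr.eval]
  · simp [Expr.eval, h1]

theorem runs_powerLoop {k T₀ G Q b d : ℕ} (h3 : s.reg 3 = Q) (h5 : s.reg 5 = G)
    (h7 : s.reg 7 = T₀) (h8 : s.reg 8 = b) (h9 : s.reg 9 = 1) (h10 : s.reg 10 = 1)
    (h11 : s.reg 11 = k)
    (hd : ∀ i < k, (G.size + 1) * (G.size + 1) +
      ((T₀ * G ^ (2 * i)).size + 1) * ((G * G).size + 1) + ((Q ^ i).size + 1) * (Q.size + 1) +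
      ((b ^ i).size + 1) * (b.size + 1) ≤ d) :
    Runs E (.loop (.reg 11) powerStep) s (k * (d + 20 + 2) + 2) fun u =>
      u.arr = s.arr ∧ u.drawn = s.drawn ∧
      (∀ r, r ≠ 7 → r ≠ 9 → r ≠ 10 → r ≠ 11 → u.reg r = s.reg r) ∧
      u.reg 7 = T₀ * G ^ (2 * k) ∧ u.reg 9 = Q ^ k ∧ u.reg 10 = b ^ k := by
  refine (Runs.loop (fun i u => i ≤ k ∧ u.arr = s.arr ∧ u.drawn = s.drawn ∧
    (∀ r, r ≠ 7 → r ≠ 9 → r ≠ 10 → r ≠ 11 → u.reg r = s.reg r) ∧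
    u.reg 7 = T₀ * G ^ (2 * (k - i)) ∧ u.reg 9 = Q ^ (k - i) ∧ u.reg 10 = b ^ (k - i) ∧
    u.reg 11 = i) ?_ ?_ ?_ (i := k) (s := s)
    ⟨le_rfl, rfl, rfl, fun _ _ _ _ _ => rfl, by simpa using h7, by simpa using h9,
      by simpa using h10, h11⟩).mono le_rfl ?_
  · rintro i u -
    simp [Expr.cost]
  · rintro i u ⟨-, -, -, -, -, -, -, h⟩
    simp [Expr.eval, h]
  · rintro i u ⟨hi, ha, hd', hr, h7, h9, h10, h11⟩
    have e0 : k - i = k - (i + 1) + 1 := by omega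
    have e3 := (hr 3 (by norm_num) (by norm_num) (by norm_num) (by norm_num)).trans h3
    have e5 := (hr 5 (by norm_num) (by norm_num) (by norm_num) (by norm_num)).trans h5
    have e8 := (hr 8 (by norm_num) (by norm_num) (by norm_num) (by norm_num)).trans h8
    refine ⟨_, _, .seq (.set _ _ _) (.seq (.set _ _ _) (.seq (.set _ _ _) (.set _ _ _))), ?_,
      by omega, ha, hd', ?_, ?_, ?_, ?_, ?_⟩
    · have := hd (k - (i + 1)) (by omega)
      simp only [Expr.cost, Expr.eval, reg_setReg, Nat.reduceEqDiff, if_false, e3, e5, e8, h7, h9,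
        h10]
      omega
    · intro r g1 g3 g4 g5
      simp [g1, g3, g4, g5, hr r]
    · simp [Expr.eval, h7, e5, e0]; ring
    · simp [Expr.eval, h9, e3, e0, pow_succ]
    · simp [Expr.eval, h10, e8, e0, pow_succ]
    · simp [Expr.eval, h11]
  · rintro u ⟨-, ha, hd, hr, h7, h9, h10, -⟩
    exact ⟨ha, hd, hr, by simpa using h7, by simpa using h9, by simpa using h10⟩

theorem runs_denominatorLoop {n k b d : ℕ} (h8 : s.reg 8 = b) (h10 : s.reg 10 = b ^ k)
    (h11 : s.reg 11 = n) (hd : ∀ i < n + k, ((b ^ i).size + 1) * (b.size + 1) ≤ d) :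
    Runs E (.loop (.reg 11) denominatorStep) s (n * (d + 10 + 2) + 2) fun u =>
      u.arr = s.arr ∧ u.drawn = s.drawn ∧
      (∀ r, r ≠ 10 → r ≠ 11 → u.reg r = s.reg r) ∧ u.reg 10 = b ^ (n + k) := by
  refine (Runs.loop (fun i u => i ≤ n ∧ u.arr = s.arr ∧ u.drawn = s.drawn ∧
    (∀ r, r ≠ 10 → r ≠ 11 → u.reg r = s.reg r) ∧ u.reg 10 = b ^ (n - i + k) ∧
    u.reg 11 = i) ?_ ?_ ?_ (i := n) (s := s)
    ⟨le_rfl, rfl, rfl, fun _ _ _ => rfl, by simpa using h10, h11⟩).mono le_rfl ?_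
  · rintro i u -
    simp [Expr.cost]
  · rintro i u ⟨-, -, -, -, -, h⟩
    simp [Expr.eval, h]
  · rintro i u ⟨hi, ha, hd', hr, h10, h11⟩
    have e0 : n - i + k = n - (i + 1) + k + 1 := by omega
    have e8 := (hr 8 (by norm_num) (by norm_num)).trans h8
    refine ⟨_, _, .seq (.set _ _ _) (.set _ _ _), ?_, by omega, ha, hd', ?_, ?_, ?_⟩
    · have := hd (n - (i + 1) + k) (by omega)
      simp only [Expr.cost, Expr.eval, e8, h10]
      omega
    · intro r g4 g5
      simp [g4, g5, hr r]
    · simp [Expr.eval, h10, e8, e0, pow_succ]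
    · simp [Expr.eval, h11]
  · rintro u ⟨-, ha, hd, hr, h10, -⟩
    exact ⟨ha, hd, hr, by simpa using h10⟩

theorem size_pow_le {Q n L i : ℕ} (hL : Q ^ n < 2 ^ L) (hQ : 0 < Q) (hi : i ≤ n) :
    (Q ^ i).size ≤ L := by
  rw [Nat.size_le]
  exact lt_of_le_of_lt (Nat.pow_le_pow_right hQ hi) hL

theorem runs_computeParameters {n k a b G M T L : ℕ} (h0 : s.reg 0 = n) (h1 : s.reg 1 = k)
    (h2 : s.reg 2 = a) (h3 : s.reg 3 = a + b) (h5 : s.reg 5 = G) (h6 : s.reg 6 = M)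
    (hk : k ≤ n) (hn : 1 ≤ n) (hG : 1 ≤ G) (hGL : G ≤ L) (hL : n * (a + b) ^ n < 2 ^ L)
    (hL' : a + b ≤ L) (hnL : n ≤ L) (hb : b ≠ 0)
    (hT : T = 128 * n ^ 2 * G ^ (2 * k) * (M + 1)) :
    Runs E computeParameters s (200 * n * T * (L + 1) ^ 2) fun u =>
      u.arr = s.arr ∧ u.drawn = s.drawn ∧
      (∀ r, r < 7 ∨ r = 12 ∨ r = 13 → u.reg r = s.reg r) ∧
      u.reg 7 = T ∧ u.reg 8 = b ∧ u.reg 9 = (a + b) ^ k ∧ u.reg 10 = b ^ (n + k) ∧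
      u.reg 14 = T := by
  set K := T * (L + 1) ^ 2 with hK
  have hG2 : 1 ≤ G ^ (2 * k) := Nat.one_le_pow _ _ hG
  have hTM : 128 * n ^ 2 * (M + 1) ≤ T := by
    rw [hT]
    calc 128 * n ^ 2 * (M + 1) = 128 * n ^ 2 * 1 * (M + 1) := by ring
      _ ≤ _ := by gcongr
  have hn2 : 1 ≤ n ^ 2 := Nat.one_le_pow _ _ hn
  have hM1 : 1 * (M + 1) ≤ 128 * n ^ 2 * (M + 1) := by gcongr; omega
  have hT1 : 1 ≤ T := by omega
  have hLL : (L + 1) ^ 2 ≤ K := Nat.le_mul_of_pos_left _ (by omega)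
  have hTL : T * (L + 1) ≤ K := by
    rw [hK, sq, ← mul_assoc]; exact Nat.le_mul_of_pos_right _ (by omega)
  have hTK : T ≤ K := (Nat.le_mul_of_pos_right T (by omega)).trans hTL
  have hLK : L + 1 ≤ K := (Nat.le_mul_of_pos_left (L + 1) hT1).trans hTL
  have hsG : G.size ≤ L := (size_le_self G).trans hGL
  have hsn : n.size ≤ L := (size_le_self n).trans hnL
  have hsQ : (a + b).size ≤ L := (size_le_self _).trans hL'
  have hsb : b.size ≤ L := (size_le_self _).trans (by omega)
  have hQn : (a + b) ^ n < 2 ^ L := lt_of_le_of_lt (Nat.le_mul_of_pos_left _ (by omega)) hL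
  have hbn : b ^ (n + n) < 2 ^ (2 * L) := by
    rw [two_mul, pow_add, pow_add]
    have := lt_of_le_of_lt (Nat.pow_le_pow_left (Nat.le_add_left b a) n) hQn
    exact Nat.mul_lt_mul'' this this
  have hcV : ∀ i ≤ n + n, ((b ^ i).size + 1) * (b.size + 1) ≤ 2 * K := by
    intro i hi
    have := size_pow_le hbn (by omega) hi
    calc _ ≤ (2 * L + 2) * (L + 1) := by gcongr; omega
      _ = 2 * (L + 1) ^ 2 := by ring
      _ ≤ _ := by omega
  refine (((runs_startProducts (E := E) h0 h1 h2 h3 h6).mono (d := 70 * K) ?_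
    fun _ h => h).seq (d := (k * (8 * K + 20 + 2) + 2) + (2 + ((n * (2 * K + 10 + 2) + 2) + 2)))
    ?_).mono ?_ fun _ h => h
  · have e1 := mulCost_le hsn hsn
    have e2 := size_mul_le n n
    have e3 : (128 : ℕ).size = 8 := by decide
    have e4 := size_mul_le 128 (n * n)
    have e5 := size_le_self (M + 1)
    have e6 : ((128 * (n * n)).size + 1) * ((M + 1).size + 1) ≤ 18 * K := by
      calc _ ≤ (9 * (L + 1)) * (T + T) := by gcongr <;> omega
        _ = 18 * (T * (L + 1)) := by ring
        _ ≤ _ := by omega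
    omega
  · rintro s₁ ⟨ha₁, hd₁, hr₁, h7, h8, h9, h10, h11⟩
    refine (runs_powerLoop ((hr₁ 3 (by norm_num)).trans h3) ((hr₁ 5 (by norm_num)).trans h5)
      h7 h8 h9 h10 h11 ?_).seq ?_
    · intro i hi
      have f1 := mulCost_le hsG hsG
      have f2 := size_mul_le G G
      have f3 : (128 * n ^ 2 * (M + 1) * G ^ (2 * i)).size ≤ T := by
        refine (size_le_self _).trans ?_
        rw [hT, mul_right_comm _ (G ^ (2 * k))]
        gcongr
      have f4 : ((128 * n ^ 2 * (M + 1) * G ^ (2 * i)).size + 1) * ((G * G).size + 1) ≤ 4 * K := by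
        calc _ ≤ (T + T) * (2 * L + 2) := by gcongr <;> omega
          _ = 4 * (T * (L + 1)) := by ring
          _ ≤ _ := by omega
      have f5 := mulCost_le (size_pow_le hQn (by omega) (by omega : i ≤ n)) hsQ
      have f6 := hcV i (by omega)
      omega
    rintro s₂ ⟨ha₂, hd₂, hr₂, h7, h9, h10⟩
    refine Runs.seq (R' := fun u => u = s₂.setReg 11 n) ⟨_, _, .set _ _ _, by simp [Expr.cost],
      by simp [Expr.eval, hr₂ 0, hr₁ 0, h0]⟩ ?_
    rintro _ rfl
    refine (runs_denominatorLoop (n := n) (k := k) (b := b) (by simp [hr₂ 8, h8]) (by simpa using h10)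
      (by simp) fun i hi => hcV i (by omega)).seq ?_
    rintro u ⟨ha, hd, hr, h10'⟩
    refine ⟨_, _, .set _ _ _, by simp [Expr.cost], ha.trans (ha₂.trans ha₁),
      hd.trans (hd₂.trans hd₁), ?_, ?_, ?_, ?_, ?_, ?_⟩
    · intro r hr'
      have g1 : r ≠ 7 := by omega
      have g3 : r ≠ 9 := by omega
      have g4 : r ≠ 10 := by omega
      have g5 : r ≠ 11 := by omega
      have g6 : r ≠ 14 := by omega
      rw [reg_setReg, if_neg g6, hr r g4 g5, reg_setReg, if_neg g5, hr₂ r g1 g3 g4 g5, hr₁ r hr']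
    · simp [hr 7, h7, hT]; ring
    · simp [hr 8, hr₂ 8, h8]
    · simp [hr 9, h9]
    · simp [h10']
    · simp [Expr.eval, hr 7, h7, hT]; ring
  · have e1 : k * (8 * K + 20 + 2) ≤ n * (8 * K + 20 + 2) := by gcongr
    have e2 : 200 * n * T * (L + 1) ^ 2 = 200 * (n * K) := by rw [hK]; ring
    have e3 : K ≤ n * K := Nat.le_mul_of_pos_left _ (by omega)
    have e4 : n ≤ n * K := Nat.le_mul_of_pos_right _ (by omega)
    rw [e2]
    rw [show n * (8 * K + 20 + 2) = 8 * (n * K) + 22 * n by ring] at e1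
    rw [show n * (2 * K + 10 + 2) = 2 * (n * K) + 12 * n by ring]
    omega

end Parameters

/-! ### The algorithm -/

/-- Chooses the parameters, accumulates the estimates over all traces, and rounds their mean. -/
def countOccurrences : Prog :=
  .seq approximateRate
  (.seq approximateConfidence
  (.seq computeParameters
  (.seq (.loop (.reg 14) traceStep)
  roundQuotient)))

/-- An estimate within `1 / 2` of `μ` is rounded to `μ`, in the integers that the machine uses. -/
theorem rounding_bounds {n k p q a b T μ : ℕ} {σ : ℝ} (hb : b ≠ 0)
    (hpq : (p : ℝ) - q = b ^ n * σ)
    (h : |((a + b : ℕ) / b : ℝ) ^ k * σ - T * μ| < T / 2) :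
    2 * (q * (a + b) ^ k) + μ * (2 * (T * b ^ (n + k))) ≤
      2 * (p * (a + b) ^ k) + T * b ^ (n + k) ∧
    2 * (p * (a + b) ^ k) + T * b ^ (n + k) <
      2 * (q * (a + b) ^ k) + (μ + 1) * (2 * (T * b ^ (n + k))) := by
  have hb' : (0 : ℝ) < b := by exact_mod_cast Nat.pos_of_ne_zero hb
  have hV : (0 : ℝ) < b ^ (n + k) := by positivity
  have h1 : (b : ℝ) ^ (n + k) * (((a + b : ℕ) / b : ℝ) ^ k * σ) = (a + b) ^ k * (p - q) := by
    rw [hpq, div_pow, pow_add]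
    push_cast
    field_simp
  obtain ⟨h2, h3⟩ := abs_lt.1 h
  have h4 := mul_lt_mul_of_pos_left h2 hV
  have h5 := mul_lt_mul_of_pos_left h3 hV
  rw [mul_sub, h1] at h4 h5
  have h6 : (2 * (q * (a + b) ^ k) + μ * (2 * (T * b ^ (n + k))) : ℝ) ≤
      2 * (p * (a + b) ^ k) + T * b ^ (n + k) := by linarith
  have h7 : (2 * (p * (a + b) ^ k) + T * b ^ (n + k) : ℝ) <
      2 * (q * (a + b) ^ k) + (μ + 1) * (2 * (T * b ^ (n + k))) := by
    have : (0 : ℝ) ≤ T * b ^ (n + k) := by positivity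
    linarith
  exact ⟨by exact_mod_cast h6, by exact_mod_cast h7⟩

/-- The number `L` bounds the bit length of the table entries, since `n < 2 ^ n` and `Q < 2 ^ Q`. -/
theorem runs_countOccurrences {E : Env} {A : ℕ → ℕ} (hA0 : A 0 = 0)
    (hA : ∀ i, A (i + 1) = 2 * A i + E.digit₁ (i + 1)) {n g m M T L b : ℕ} (hgm : g ≤ m)
    (hg : ∀ i ≤ g, (2 * A i + 3 ≤ 2 ^ i ↔ i = g))
    (hm : ∀ i, g ≤ i → i ≤ m → (64 * n ^ 2 ≤ 2 ^ i ↔ i = m))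
    (hM1 : 1 ≤ M) (hM : E.digit₂ M = 1) (hM' : ∀ i, 1 ≤ i → i < M → E.digit₂ i = 0)
    (hb : b ≠ 0) (hQ : A m + b = 2 ^ m) (hL : L = n + 2 ^ m * n)
    {c : Bool} {w : List Bool} (hw : w.length + 1 ≤ n)
    (hT : T = 128 * n ^ 2 * (2 ^ g) ^ (2 * (w.length + 1)) * (M + 1))
    (hy : ∀ i, (E.trace i).length ≤ n) :
    Runs E countOccurrences (initialState n (c :: w)) (2000 * n ^ 2 * T * (L + 1) ^ 3) fun u =>
      u.drawn = T ∧ ∀ μ ≤ n, |((A m + b : ℕ) / b : ℝ) ^ (w.length + 1) *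
          ∑ i ∈ Finset.range T, occurrenceWeight (-(A m / b : ℝ)) c w (E.trace i) - T * μ| < T / 2 →
        u.reg 0 = μ := by
  have hn : 1 ≤ n := by omega
  have hQL : 2 ^ m ≤ L := by
    have : 2 ^ m * 1 ≤ 2 ^ m * n := by gcongr
    omega
  have hmL : m ≤ L := Nat.lt_two_pow_self.le.trans hQL
  have hgL : 2 ^ g ≤ L := (Nat.pow_le_pow_right (by norm_num) hgm).trans hQL
  have hnL : n ≤ L := by omega
  have hsize : n * (A m + b) ^ n < 2 ^ L := by
    rw [hQ, hL, pow_add, ← pow_mul]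
    have h1 : n < 2 ^ n := Nat.lt_two_pow_self
    have h2 : 2 ^ (m * n) ≤ 2 ^ (2 ^ m * n) := by
      gcongr
      · norm_num
      · exact Nat.lt_two_pow_self.le
    exact Nat.mul_lt_mul_of_lt_of_le h1 h2 (by positivity)
  have hQL' : A m + b ≤ L := hQ.trans_le hQL
  have hQn : (A m + b) ^ n < 2 ^ L := lt_of_le_of_lt (Nat.le_mul_of_pos_left _ (by omega)) hsize
  have hG2 : 1 ≤ (2 ^ g) ^ (2 * (w.length + 1)) := Nat.one_le_pow _ _ (Nat.two_pow_pos g)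
  have hTM : M + 1 ≤ T := by
    rw [hT]
    exact Nat.le_mul_of_pos_left _ (by positivity)
  refine (runs_approximateRate (E := E) (s := initialState n (c :: w)) hA0 hA hgm hg hm rfl rfl
    hnL hmL).seq (d := (20 * M + 10) + (200 * n * T * (L + 1) ^ 2 +
      ((T * (400 * n ^ 2 * (L + 1) ^ 2 + 2) + 2) + (100 * T * (L + 1) ^ 2 + (22 * n + 4)))))
    ?_ |>.mono ?_ fun _ h => h
  · rintro s₁ ⟨ha₁, hd₁, hr₁, h2, h3, h5⟩
    refine (runs_approximateConfidence hM1 hM hM').seq ?_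
    rintro s₂ ⟨ha₂, hd₂, hr₂, h6⟩
    have hr : ∀ r, r ≠ 2 → r ≠ 3 → r ≠ 4 → r ≠ 5 → r ≠ 6 →
        s₂.reg r = (initialState n (c :: w)).reg r := fun r e2 e3 e4 e5 e6 =>
      (hr₂ r e6).trans (hr₁ r e2 e3 e4 e5)
    refine (runs_computeParameters (n := n) (k := w.length + 1) (a := A m) (b := b) (G := 2 ^ g)
      (M := M) (T := T) (L := L) ?_ ?_ ?_ ?_ ?_ h6 hw hn (Nat.one_le_two_pow) hgL hsize hQL' hnL hb
      hT).seq ?_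
    · rw [hr 0] <;> simp [initialState]
    · rw [hr 1] <;> simp [initialState]
    · rw [hr₂ 2 (by norm_num), h2]
    · rw [hr₂ 3 (by norm_num), h3, hQ]
    · rw [hr₂ 5 (by norm_num), h5]
    rintro s₃ ⟨ha₃, hd₃, hr₃, h7, h8, h9, h10, h14⟩
    have hprep : Prepared n (A m) b (c :: w) s₃ := by
      refine ⟨?_, ?_, ?_, h8, ?_⟩
      · rw [hr₃ 0 (by norm_num), hr 0] <;> simp [initialState]
      · rw [hr₃ 1 (by norm_num), hr 1] <;> simp [initialState]
      · rw [hr₃ 2 (by norm_num), hr₂ 2 (by norm_num), h2]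
      · intro j hj
        rw [ha₃, ha₂, ha₁]
        simp only [initialState, if_true, writeBits]
        rw [dif_pos hj]
    refine (runs_traceLoop hprep hb hw hsize hQL' hy ?_ ?_ ?_ h14).seq ?_
    · rw [hd₃, hd₂, hd₁]; rfl
    · rw [hr₃ 12 (by norm_num), hr 12] <;> simp [initialState]
    · rw [hr₃ 13 (by norm_num), hr 13] <;> simp [initialState]
    rintro s₄ ⟨⟨hr₄, -⟩, hd₄, hsum, hle⟩
    have hacc : ∀ x, x ≤ s₄.reg 12 + s₄.reg 13 → x.size ≤ T + L := by
      intro x hx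
      rw [Nat.size_le, pow_add]
      exact lt_of_le_of_lt (hx.trans hle) (Nat.mul_lt_mul'' Nat.lt_two_pow_self hsize)
    refine (runs_roundQuotient (n := n) (p := s₄.reg 12) (q := s₄.reg 13) (T := T)
      (U := (A m + b) ^ (w.length + 1)) (V := b ^ (n + (w.length + 1))) (L := L) ?_ rfl rfl ?_ ?_ ?_
      (hacc _ (by omega)) (hacc _ (by omega)) (size_pow_le hQn (by omega) hw) ?_
      (by omega)).mono le_rfl ?_
    · rw [hr₄ 0 (by norm_num), hprep.len]
    · rw [hr₄ 7 (by norm_num), h7]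
    · rw [hr₄ 9 (by norm_num), h9]
    · rw [hr₄ 10 (by norm_num), h10]
    · refine size_pow_le (n := n + n) ?_ (by omega) (by omega)
      rw [two_mul, pow_add, pow_add]
      have := lt_of_le_of_lt (Nat.pow_le_pow_left (Nat.le_add_left b (A m)) n) hQn
      exact Nat.mul_lt_mul'' this this
    · rintro u ⟨hd, h⟩
      refine ⟨hd.trans hd₄, fun μ hμ habs => ?_⟩
      obtain ⟨h1, h2⟩ := rounding_bounds hb hsum habs
      exact h μ hμ h1 h2
  · set K := (L + 1) ^ 2 with hK
    have hK1 : 1 ≤ K := Nat.one_le_pow _ _ (by omega)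
    have e1 : (L + 1) ^ 3 = K * (L + 1) := pow_succ _ _
    have e2 : n ≤ n ^ 2 := Nat.le_self_pow (by norm_num) n
    set N := n ^ 2
    have e3 : N * T * K ≤ N * T * (K * (L + 1)) := by
      gcongr; exact Nat.le_mul_of_pos_right _ (by omega)
    have e4 : n * T * K ≤ N * T * K := by gcongr
    have e5 : T * K ≤ N * T * K := by
      gcongr; exact Nat.le_mul_of_pos_left _ (by omega)
    have e6 : T ≤ T * K := Nat.le_mul_of_pos_right _ (by omega)
    have e7 : N ≤ N * T * K := by
      rw [mul_assoc]; exact Nat.le_mul_of_pos_right _ (Nat.mul_pos (by omega) (by omega))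
    have e8 : K * (L + 1) ≤ N * T * (K * (L + 1)) :=
      Nat.le_mul_of_pos_left _ (Nat.mul_pos (by omega) (by omega))
    rw [e1]
    have f1 : 200 * n * T * K = 200 * (n * T * K) := by ring
    have f2 : T * (400 * N * K + 2) = 400 * (N * T * K) + 2 * T := by ring
    have f3 : 100 * T * K = 100 * (T * K) := by ring
    have f4 : 2000 * N * T * (K * (L + 1)) = 2000 * (N * T * (K * (L + 1))) := by ring
    rw [f1, f2, f3, f4]
    omega

/-! ### The digits of the parameters -/

/-- The recursion by which the digits of `r` yield its truncations. -/
theorem floor_two_pow_succ (r : ℝ) (i : ℕ) :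
    ⌊r * 2 ^ (i + 1)⌋₊ = 2 * ⌊r * 2 ^ i⌋₊ + binaryDigit r (i + 1) := by
  have h : ⌊r * 2 ^ i⌋₊ = ⌊r * 2 ^ (i + 1)⌋₊ / 2 := by
    rw [← Nat.floor_div_natCast]
    congr 1
    push_cast
    rw [pow_succ]
    ring
  rw [binaryDigit, h]
  omega

/-- The position `M` of the first nonzero digit of `τ` satisfies `2 ^ (-M) ≤ τ < 2 ^ (1 - M)`. -/
theorem exists_confidence {τ : ℝ} (hτ : 0 < τ) (hτ1 : τ < 1) :
    ∃ M, 1 ≤ M ∧ binaryDigit τ M = 1 ∧ (∀ i, 1 ≤ i → i < M → binaryDigit τ i = 0) ∧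
      Real.log (2 / τ) ≤ M + 1 ∧ (M + 1 : ℝ) ≤ 4 * Real.log (2 / τ) := by
  have hex : ∃ i : ℕ, 1 ≤ τ * 2 ^ i := by
    obtain ⟨i, hi⟩ := pow_unbounded_of_one_lt (1 / τ) (by norm_num : (1 : ℝ) < 2)
    refine ⟨i, ?_⟩
    rw [div_lt_iff₀ hτ] at hi
    linarith
  classical
  obtain ⟨M, h1, hmin⟩ : ∃ M, 1 ≤ τ * 2 ^ M ∧ ∀ i < M, ¬ 1 ≤ τ * 2 ^ i :=
    ⟨Nat.find hex, Nat.find_spec hex, fun i hi => Nat.find_min hex hi⟩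
  have hfloor : ∀ i < M, ⌊τ * 2 ^ i⌋₊ = 0 := fun i hi =>
    Nat.floor_eq_zero.2 (not_le.1 (hmin i hi))
  have hM : 1 ≤ M := by
    by_contra h
    obtain rfl : M = 0 := by omega
    rw [pow_zero, mul_one] at h1
    linarith
  obtain ⟨N, rfl⟩ : ∃ N, M = N + 1 := ⟨M - 1, by omega⟩
  have h2 : τ * 2 ^ N < 1 := not_le.1 (hmin N (by omega))
  have h2N : (0 : ℝ) < 2 ^ N := by positivity
  refine ⟨N + 1, hM, ?_, fun i _ hi => by rw [binaryDigit, hfloor i hi], ?_, ?_⟩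
  · have h3 := floor_two_pow_succ τ N
    rw [hfloor N (by omega)] at h3
    have h4 : 1 ≤ ⌊τ * 2 ^ (N + 1)⌋₊ := Nat.le_floor (by simpa using h1)
    have h5 : binaryDigit τ (N + 1) < 2 := Nat.mod_lt _ (by norm_num)
    omega
  · have h3 : 2 / τ ≤ 2 ^ (N + 1 + 1) := by
      rw [div_le_iff₀ hτ, pow_succ]; linarith
    have h4 := Real.log_le_log (by positivity) h3
    rw [Real.log_pow] at h4
    push_cast at h4 ⊢
    have h5 : Real.log 2 ≤ 1 := by have := Real.log_two_lt_d9; linarith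
    nlinarith
  · have h3 : 2 ^ (N + 1) ≤ 2 / τ := by
      rw [le_div_iff₀ hτ, pow_succ]; linarith
    have h4 := Real.log_le_log (by positivity) h3
    rw [Real.log_pow] at h4
    push_cast at h4 ⊢
    have h5 : 1 / 2 ≤ Real.log 2 := by have := Real.log_two_gt_d9; linarith
    have h6 : (0 : ℝ) ≤ N := Nat.cast_nonneg _
    nlinarith

/-- The precisions `2 ^ g` and `2 ^ m` at which the two loops of `approximateRate` stop. -/
theorem exists_precision {δ : ℝ} (h0 : 0 ≤ δ) (hδ : δ < 1 / 2) (n : ℕ) (hn : 1 ≤ n) :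
    ∃ g m : ℕ, g ≤ m ∧ (∀ i ≤ g, (2 * ⌊δ * 2 ^ i⌋₊ + 3 ≤ 2 ^ i ↔ i = g)) ∧
      (∀ i, g ≤ i → i ≤ m → (64 * n ^ 2 ≤ 2 ^ i ↔ i = m)) ∧
      1 ≤ (1 - 2 * δ) * ((2 ^ g : ℕ) : ℝ) ∧ (1 - 2 * δ) * ((2 ^ g : ℕ) : ℝ) ≤ 4 ∧
      64 * n ^ 2 ≤ 2 ^ m ∧ 2 ^ m ≤ 128 * n ^ 2 * 2 ^ g := by
  classical
  have hex : ∃ i : ℕ, 2 * ⌊δ * 2 ^ i⌋₊ + 3 ≤ 2 ^ i := by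
    obtain ⟨i, hi⟩ := pow_unbounded_of_one_lt (3 / (1 - 2 * δ)) (by norm_num : (1 : ℝ) < 2)
    refine ⟨i, ?_⟩
    rw [div_lt_iff₀ (by linarith)] at hi
    have := Nat.floor_le (show 0 ≤ δ * 2 ^ i by positivity)
    have h : (2 * ⌊δ * 2 ^ i⌋₊ + 3 : ℝ) ≤ 2 ^ i := by linarith
    exact_mod_cast h
  obtain ⟨g, hg, hgmin⟩ : ∃ g, 2 * ⌊δ * 2 ^ g⌋₊ + 3 ≤ 2 ^ g ∧
      ∀ i < g, ¬ 2 * ⌊δ * 2 ^ i⌋₊ + 3 ≤ 2 ^ i :=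
    ⟨Nat.find hex, Nat.find_spec hex, fun i hi => Nat.find_min hex hi⟩
  have hex' : ∃ i : ℕ, g ≤ i ∧ 64 * n ^ 2 ≤ 2 ^ i :=
    ⟨g + 64 * n ^ 2, by omega, (Nat.lt_two_pow_self.le).trans
      (Nat.pow_le_pow_right (by norm_num) (by omega))⟩
  obtain ⟨m, ⟨hgm, hm⟩, hmmin⟩ : ∃ m, (g ≤ m ∧ 64 * n ^ 2 ≤ 2 ^ m) ∧
      ∀ i < m, ¬ (g ≤ i ∧ 64 * n ^ 2 ≤ 2 ^ i) :=
    ⟨Nat.find hex', Nat.find_spec hex', fun i hi => Nat.find_min hex' hi⟩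
  refine ⟨g, m, hgm, fun i hi => ⟨fun h => ?_, fun h => h ▸ hg⟩,
    fun i hi hi' => ⟨fun h => ?_, fun h => h ▸ hm⟩, ?_, ?_, hm, ?_⟩
  · by_contra hne
    exact hgmin i (by omega) h
  · by_contra hne
    exact hmmin i (by omega) ⟨hi, h⟩
  · have h1 := Nat.lt_floor_add_one (δ * 2 ^ g)
    have h2 : (2 * ⌊δ * 2 ^ g⌋₊ + 3 : ℝ) ≤ 2 ^ g := by exact_mod_cast hg
    push_cast
    linarith
  · cases g with
    | zero => push_cast; linarith
    | succ g =>
      have h1 := Nat.floor_le (show 0 ≤ δ * 2 ^ g by positivity)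
      have h2 : 2 ^ g ≤ 2 * ⌊δ * 2 ^ g⌋₊ + 2 := by
        have := hgmin g (by omega)
        omega
      have h3 : (2 ^ g : ℝ) ≤ 2 * ⌊δ * 2 ^ g⌋₊ + 2 := by exact_mod_cast h2
      push_cast
      rw [pow_succ]
      linarith
  · have h1 : 1 ≤ n ^ 2 := Nat.one_le_pow _ _ hn
    have h2 : 1 ≤ 2 ^ g := Nat.one_le_two_pow
    rcases hgm.eq_or_lt with h | h
    · rw [← h]
      exact Nat.le_mul_of_pos_left _ (by omega)
    · obtain ⟨l, rfl⟩ : ∃ l, m = l + 1 := ⟨m - 1, by omega⟩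
      have h3 : 2 ^ l < 64 * n ^ 2 := by
        have := hmmin l (by omega)
        by_contra hcon
        exact this ⟨by omega, by omega⟩
      calc 2 ^ (l + 1) = 2 ^ l * 2 := pow_succ _ _
        _ ≤ 128 * n ^ 2 * 1 := by omega
        _ ≤ _ := by gcongr

/-- With `B = 1 / (1 / 2 - δ)`, the number of traces and the running time are polynomial in `n` and
`B ^ k`, and linear in `ℓ = ln (2 / τ)`. -/
theorem resources_le {n k C : ℕ} {B ℓ T Lr Q G M : ℝ} (hn : 1 ≤ n) (hk : 1 ≤ k) (hB : 2 ≤ B)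
    (hG0 : 1 ≤ G) (hG : G ≤ 2 * B) (hM0 : 0 ≤ M) (hM : M ≤ 4 * ℓ) (hQ0 : 0 ≤ Q)
    (hQ : Q ≤ 128 * n ^ 2 * G)
    (hT : T = 128 * n ^ 2 * G ^ (2 * k) * M) (hL : Lr = n + Q * n)
    (hC : 2000 * 512 * 130 ^ 3 ≤ C) :
    T ≤ 2000 * n ^ 2 * T * (Lr + 1) ^ 3 ∧
      2000 * n ^ 2 * T * (Lr + 1) ^ 3 ≤ C * (n : ℝ) ^ C * B ^ (C * k) * ℓ := by
  have hn' : (1 : ℝ) ≤ n := by exact_mod_cast hn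
  have hℓ : 0 ≤ ℓ := by linarith
  have hT0 : 0 ≤ T := by rw [hT]; positivity
  have hL0 : 0 ≤ Lr := by rw [hL]; positivity
  have hn2 : (1 : ℝ) ≤ (n : ℝ) ^ 2 := one_le_pow₀ hn'
  have hn3 : (n : ℝ) ≤ (n : ℝ) ^ 3 := le_self_pow₀ hn' (by norm_num)
  have hGB : G ≤ B ^ 2 := by nlinarith
  constructor
  · have h1 : 1 ≤ (Lr + 1) ^ 3 := one_le_pow₀ (by linarith)
    calc T = 1 * 1 * T * 1 := by ring
      _ ≤ 2000 * n ^ 2 * T * (Lr + 1) ^ 3 := by gcongr; norm_num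
  · have h1 : Lr + 1 ≤ 130 * n ^ 3 * B ^ 2 := by
      have : Lr + 1 ≤ 130 * n ^ 3 * G := by
        calc Lr + 1 = n + Q * n + 1 := by rw [hL]
          _ ≤ n ^ 3 * G + 128 * n ^ 2 * G * n + n ^ 3 * G := by
            have e1 : (n : ℝ) ^ 3 * 1 ≤ n ^ 3 * G := by gcongr
            have e2 : Q * n ≤ 128 * n ^ 2 * G * n := by gcongr
            linarith
          _ = 130 * n ^ 3 * G := by ring
      exact this.trans (by gcongr)
    have h2 : T ≤ 512 * n ^ 2 * B ^ (4 * k) * ℓ := by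
      calc T ≤ 128 * n ^ 2 * (B ^ 2) ^ (2 * k) * (4 * ℓ) := by rw [hT]; gcongr
        _ = 512 * n ^ 2 * B ^ (4 * k) * ℓ := by rw [← pow_mul]; ring
    have hB1 : 1 ≤ B := by linarith
    have h3 : B ^ 6 ≤ B ^ (6 * k) := pow_le_pow_right₀ hB1 (by omega)
    have hCr : (2000 * 512 * 130 ^ 3 : ℝ) ≤ C := by exact_mod_cast hC
    calc 2000 * n ^ 2 * T * (Lr + 1) ^ 3
        ≤ 2000 * n ^ 2 * (512 * n ^ 2 * B ^ (4 * k) * ℓ) * (130 * n ^ 3 * B ^ 2) ^ 3 := by gcongr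
      _ = (2000 * 512 * 130 ^ 3) * (n : ℝ) ^ 13 * (B ^ (4 * k) * B ^ 6) * ℓ := by ring
      _ ≤ (2000 * 512 * 130 ^ 3) * (n : ℝ) ^ 13 * (B ^ (4 * k) * B ^ (6 * k)) * ℓ := by gcongr
      _ = (2000 * 512 * 130 ^ 3) * (n : ℝ) ^ 13 * B ^ (10 * k) * ℓ := by
        rw [← pow_add]; congr 3; ring
      _ ≤ C * (n : ℝ) ^ C * B ^ (C * k) * ℓ := by
        have h13 : 13 ≤ C := le_trans (by norm_num) hC
        have h10 : 10 * k ≤ C * k := by gcongr; omega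
        gcongr

theorem mainTheorem8 :
    ∃ (multiplicitySmallDelta : Prog) (C : ℕ),
      ∀ (δ : unitInterval), 0 < (δ : ℝ) → (δ : ℝ) < 1 / 2 →
      ∀ (τ : ℝ), 0 < τ → τ < 1 →
      ∀ (n k : ℕ), 1 ≤ k → k ≤ n →
      ∀ (w x : List Bool), w.length = k → x.length = n →
        -- on every sequence of traces of `x` the program halts within the claimed resources
        (∀ y : ℕ → List Bool, (∀ i, y i ∈ (deletionChannel δ x).support) →
          ∃ (time : ℕ) (s : State),
            Exec (traceEnv δ τ y) multiplicitySmallDelta (initialState n w) time s ∧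
            (time : ℝ) ≤
              C * (n : ℝ) ^ C * ((1 / 2 - (δ : ℝ))⁻¹) ^ (C * k) * Real.log (2 / τ) ∧
            (s.drawn : ℝ) ≤
              C * (n : ℝ) ^ C * ((1 / 2 - (δ : ℝ))⁻¹) ^ (C * k) * Real.log (2 / τ)) ∧
        -- with probability at least `1 - τ` over the traces, the output is `#(w, x)`
        1 - τ ≤ (traceStream δ x).real {y | ∃ (time : ℕ) (s : State),
            Exec (traceEnv δ τ y) multiplicitySmallDelta (initialState n w) time s ∧
            s.reg 0 = subwordMultiplicity w x} := by
  -- The constant is kept abstract, so that no term is raised to an explicit large power.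
  obtain ⟨C, hC⟩ : ∃ C : ℕ, 2000 * 512 * 130 ^ 3 ≤ C := ⟨_, le_rfl⟩
  refine ⟨countOccurrences, C, ?_⟩
  intro δ hδ0 hδ τ hτ hτ1 n k hk hkn w x hwk hx
  obtain ⟨c, w, rfl⟩ := List.exists_cons_of_length_pos (by omega : 0 < w.length)
  obtain rfl : w.length + 1 = k := by simpa using hwk
  have hn : 1 ≤ n := by omega
  obtain ⟨M, hM1, hM, hM', hlog, hlog'⟩ := exists_confidence hτ hτ1
  obtain ⟨g, m, hgm, hg, hm, hG1, hG4, hQn, hQG⟩ := exists_precision hδ0.le hδ n hn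
  set A : ℕ → ℕ := fun i => ⌊(δ : ℝ) * 2 ^ i⌋₊ with hA
  have hAle : (A m : ℝ) ≤ δ * 2 ^ m := Nat.floor_le (by positivity)
  have hAlt : (δ : ℝ) * 2 ^ m < A m + 1 := Nat.lt_floor_add_one _
  have h2m : (0 : ℝ) < 2 ^ m := by positivity
  have hAm : A m < 2 ^ m := by
    have : (A m : ℝ) < 2 ^ m := by nlinarith
    exact_mod_cast this
  obtain ⟨b, hQ⟩ : ∃ b, A m + b = 2 ^ m := ⟨2 ^ m - A m, by omega⟩
  have hb : b ≠ 0 := by omega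
  set T := 128 * n ^ 2 * (2 ^ g) ^ (2 * (w.length + 1)) * (M + 1) with hT
  have hruns : ∀ y : ℕ → List Bool, (∀ i, y i ∈ (deletionChannel δ x).support) → _ :=
    fun y hy => runs_countOccurrences (E := traceEnv δ τ y) (A := A)
      (Nat.floor_eq_zero.2 (by rw [pow_zero, mul_one]; linarith))
      (floor_two_pow_succ δ) (b := b) (c := c) (w := w) hgm hg hm hM1 hM hM' hb hQ rfl (by omega) hT
      (fun i => hx ▸ length_le_of_mem_support_deletionChannel (hy i))
  constructor
  · intro y hy
    obtain ⟨time, s, hexec, htime, hdrawn, -⟩ := hruns y hy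
    have hB : (2 : ℝ) ≤ (1 / 2 - (δ : ℝ))⁻¹ := by
      rw [le_inv_comm₀ (by norm_num) (by linarith)]; linarith
    have hG : ((2 ^ g : ℕ) : ℝ) ≤ 2 * (1 / 2 - (δ : ℝ))⁻¹ := by
      rw [← div_eq_mul_inv, le_div_iff₀ (by linarith)]; linarith
    obtain ⟨h1, h2⟩ := resources_le (n := n) (k := w.length + 1) (C := C) (T := (T : ℝ))
      (Lr := ((n + 2 ^ m * n : ℕ) : ℝ)) (Q := ((2 ^ m : ℕ) : ℝ)) (G := ((2 ^ g : ℕ) : ℝ))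
      (M := (M : ℝ) + 1) hn hk hB (by exact_mod_cast Nat.one_le_two_pow) hG (by positivity) hlog'
      (by positivity) (by exact_mod_cast hQG) (by rw [hT]; push_cast; ring) (by push_cast; ring) hC
    refine ⟨time, s, hexec, ?_, ?_⟩
    · refine le_trans ?_ h2
      exact_mod_cast htime
    · rw [hdrawn]
      exact h1.trans h2
  · refine (le_measureReal_estimator δ hδ hτ (a := A m) (b := b) (G := 2 ^ g) (M := M) (T := T)
      c w x hx (by omega) ?_ ?_ (by rw [hQ]; exact hQn) hG1 hlog hT).trans (measureReal_mono ?_)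
    · rw [hQ]; exact_mod_cast hAle
    · rw [hQ]; exact_mod_cast hAlt
    · rintro y ⟨hy, habs⟩
      obtain ⟨time, s, hexec, -, -, hout⟩ := hruns y hy
      exact ⟨time, s, hexec, hout _
        (hx ▸ subwordMultiplicity_le_length (c :: w) (by simp) x) habs⟩
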